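/- Let $k$ be a field of characteristic zero and let $X$ be a smooth superscheme over $k$ of dimension $n|2$; that is, $X$ is a topological space with a sheaf $\mathcal O_X$ of supercommutative $k$-superalgebras, locally isomorphic to $(Z,\bigwedge^\bullet(\mathcal O_Z^{\oplus 2}))$ with $Z$ a smooth $k$-scheme of dimension $n$. Let $\Omega_X^\bullet$ be the de Rham complex of $X$ over $k$, regarded as a complex of sheaves of $\mathbb Z/2$-graded $k$-vector spaces on $X$ with even differential $d$ (so $df$ has the same parity as $f$), and let $(-)_+$ and $(-)_-$ denote even and odd parts. Let $\mathcal N\subset\mathcal O_X$ be the ideal generated by the odd functions, and for $i\ge 0$ let $F^i\Omega_X^\bullet\subset\Omega_X^\bullet$ be the subcomplex given by the ideal of the algebra $\Omega^\bullet_X$ generated by $$\mathcal N^i,\ \mathcal N^{i-1}d\mathcal N,\ \mathcal N^{i-2}(d\mathcal N)^2,\ \ldots,\ (d\mathcal N)^i.$$ Then the complexes of sheaves of $k$-vector spaces $(\Omega_X^\bullet)_-$ and $(F^2\Omega_X^\bullet)_+$ are homotopic to zero, i.e. on each of them the identity is homotopic to the zero map through $k$-linear maps of sheaves. -/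

import Mathlib

open CategoryTheory AlgebraicGeometry TopologicalSpace Opposite

universe u

noncomputable section

namespace SuperGeom

/-! ### Supercommutative algebras -/

/-- `𝒜 0` (even part) and `𝒜 1` (odd part) make the `k`-algebra `A` into a supercommutative
`k`-superalgebra. (The last field follows from the previous one if `2` is invertible in `k`.) -/
structure IsSuperalgebra {k A : Type u} [Field k] [Ring A] [Algebra k A]
    (𝒜 : ZMod 2 → Submodule k A) : Prop where
  one_mem : (1 : A) ∈ 𝒜 0
  mul_mem : ∀ (i j : ZMod 2) (a b : A), a ∈ 𝒜 i → b ∈ 𝒜 j → a * b ∈ 𝒜 (i + j)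
  internal : DirectSum.IsInternal 𝒜
  comm : ∀ (i j : ZMod 2) (a b : A), a ∈ 𝒜 i → b ∈ 𝒜 j →
    a * b = ((-1 : ℤˣ) ^ (i * j)) • (b * a)
  odd_sq : ∀ a ∈ 𝒜 1, a * a = 0

/-! ### The de Rham algebra of a superalgebra -/

/-- The relations between the symbols `a` (`Sum.inl a`) and `d a` (`Sum.inr a`), for `a` in `A`,
that define the de Rham algebra. The parity of `d a` is that of `a`, its degree is `1`, and
homogeneous forms `ω`, `η` of degrees `p`, `q` and parities `i`, `j` satisfy
`ω η = (-1) ^ (p q + i j) η ω`. -/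
inductive FormRel {k A : Type u} [Field k] [Ring A] [Algebra k A]
    (𝒜 : ZMod 2 → Submodule k A) : FreeAlgebra k (A ⊕ A) → FreeAlgebra k (A ⊕ A) → Prop
  | fn_add (a b : A) : FormRel 𝒜 (FreeAlgebra.ι k (Sum.inl (a + b)))
      (FreeAlgebra.ι k (Sum.inl a) + FreeAlgebra.ι k (Sum.inl b))
  | fn_smul (c : k) (a : A) : FormRel 𝒜 (FreeAlgebra.ι k (Sum.inl (c • a)))
      (c • FreeAlgebra.ι k (Sum.inl a))
  | fn_one : FormRel 𝒜 (FreeAlgebra.ι k (Sum.inl 1)) 1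
  | fn_mul (a b : A) : FormRel 𝒜 (FreeAlgebra.ι k (Sum.inl (a * b)))
      (FreeAlgebra.ι k (Sum.inl a) * FreeAlgebra.ι k (Sum.inl b))
  | d_add (a b : A) : FormRel 𝒜 (FreeAlgebra.ι k (Sum.inr (a + b)))
      (FreeAlgebra.ι k (Sum.inr a) + FreeAlgebra.ι k (Sum.inr b))
  | d_smul (c : k) (a : A) : FormRel 𝒜 (FreeAlgebra.ι k (Sum.inr (c • a)))
      (c • FreeAlgebra.ι k (Sum.inr a))
  | d_mul (a b : A) : FormRel 𝒜 (FreeAlgebra.ι k (Sum.inr (a * b)))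
      (FreeAlgebra.ι k (Sum.inr a) * FreeAlgebra.ι k (Sum.inl b) +
        FreeAlgebra.ι k (Sum.inl a) * FreeAlgebra.ι k (Sum.inr b))
  | fn_d (i j : ZMod 2) (a b : A) : a ∈ 𝒜 i → b ∈ 𝒜 j →
      FormRel 𝒜 (FreeAlgebra.ι k (Sum.inl a) * FreeAlgebra.ι k (Sum.inr b))
        (((-1 : ℤˣ) ^ (i * j)) • (FreeAlgebra.ι k (Sum.inr b) * FreeAlgebra.ι k (Sum.inl a)))
  | d_d (i j : ZMod 2) (a b : A) : a ∈ 𝒜 i → b ∈ 𝒜 j →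
      FormRel 𝒜 (FreeAlgebra.ι k (Sum.inr a) * FreeAlgebra.ι k (Sum.inr b))
        (((-1 : ℤˣ) ^ (1 + i * j)) •
          (FreeAlgebra.ι k (Sum.inr b) * FreeAlgebra.ι k (Sum.inr a)))
  | d_sq (a : A) : a ∈ 𝒜 0 →
      FormRel 𝒜 (FreeAlgebra.ι k (Sum.inr a) * FreeAlgebra.ι k (Sum.inr a)) 0

/-- The de Rham algebra `Ω^•_A` of a `k`-superalgebra `A`: the universal supercommutative
differential graded algebra over `k` generated by `A` in degree `0`. -/
def Forms {k A : Type u} [Field k] [Ring A] [Algebra k A] (𝒜 : ZMod 2 → Submodule k A) :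
    Type u :=
  RingQuot (FormRel 𝒜)

namespace Forms

section Algebra

variable {k A : Type u} [Field k] [Ring A] [Algebra k A] (𝒜 : ZMod 2 → Submodule k A)

instance : Ring (Forms 𝒜) := inferInstanceAs (Ring (RingQuot (FormRel 𝒜)))

instance : Algebra k (Forms 𝒜) := inferInstanceAs (Algebra k (RingQuot (FormRel 𝒜)))

/-- The quotient map from the free algebra. -/
def mk : FreeAlgebra k (A ⊕ A) →ₐ[k] Forms 𝒜 := RingQuot.mkAlgHom k (FormRel 𝒜)

theorem mk_rel {x y : FreeAlgebra k (A ⊕ A)} (h : FormRel 𝒜 x y) : mk 𝒜 x = mk 𝒜 y :=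
  RingQuot.mkAlgHom_rel k h

/-- Functions as forms of degree zero. -/
def fn : A →ₗ[k] Forms 𝒜 where
  toFun a := mk 𝒜 (FreeAlgebra.ι k (Sum.inl a))
  map_add' a b := by simpa using mk_rel 𝒜 (.fn_add a b)
  map_smul' c a := by simpa using mk_rel 𝒜 (.fn_smul c a)

/-- The differentials `d a` of functions. -/
def dfn : A →ₗ[k] Forms 𝒜 where
  toFun a := mk 𝒜 (FreeAlgebra.ι k (Sum.inr a))
  map_add' a b := by simpa using mk_rel 𝒜 (.d_add a b)
  map_smul' c a := by simpa using mk_rel 𝒜 (.d_smul c a)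

theorem mk_inl (a : A) : mk 𝒜 (FreeAlgebra.ι k (Sum.inl a)) = fn 𝒜 a := rfl

theorem mk_inr (a : A) : mk 𝒜 (FreeAlgebra.ι k (Sum.inr a)) = dfn 𝒜 a := rfl

theorem fn_one : fn 𝒜 1 = 1 := by simpa [mk_inl] using mk_rel 𝒜 .fn_one

theorem fn_mul (a b : A) : fn 𝒜 (a * b) = fn 𝒜 a * fn 𝒜 b := by
  simpa [mk_inl, mk_inr] using mk_rel 𝒜 (.fn_mul a b)

theorem dfn_mul (a b : A) : dfn 𝒜 (a * b) = dfn 𝒜 a * fn 𝒜 b + fn 𝒜 a * dfn 𝒜 b := by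
  simpa [mk_inl, mk_inr] using mk_rel 𝒜 (.d_mul a b)

theorem map_units_smul {R S : Type*} [Ring R] [Ring S] [Algebra k R] [Algebra k S]
    (f : R →ₐ[k] S) (e : ℤˣ) (x : R) : f (e • x) = e • f x := by
  rw [Units.smul_def, Units.smul_def, map_zsmul]

variable {𝒜} in
theorem fn_dfn {i j : ZMod 2} {a b : A} (ha : a ∈ 𝒜 i) (hb : b ∈ 𝒜 j) :
    fn 𝒜 a * dfn 𝒜 b = ((-1 : ℤˣ) ^ (i * j)) • (dfn 𝒜 b * fn 𝒜 a) := by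
  simpa [map_units_smul, mk_inl, mk_inr] using mk_rel 𝒜 (.fn_d i j a b ha hb)

variable {𝒜} in
theorem dfn_dfn {i j : ZMod 2} {a b : A} (ha : a ∈ 𝒜 i) (hb : b ∈ 𝒜 j) :
    dfn 𝒜 a * dfn 𝒜 b = ((-1 : ℤˣ) ^ (1 + i * j)) • (dfn 𝒜 b * dfn 𝒜 a) := by
  simpa [map_units_smul, mk_inl, mk_inr] using mk_rel 𝒜 (.d_d i j a b ha hb)

variable {𝒜} in
theorem dfn_sq {a : A} (ha : a ∈ 𝒜 0) : dfn 𝒜 a * dfn 𝒜 a = 0 := by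
  simpa [mk_inl, mk_inr] using mk_rel 𝒜 (.d_sq a ha)

/-- The de Rham algebra is generated by functions and their differentials. -/
theorem induction {P : Forms 𝒜 → Prop} (hk : ∀ c : k, P (algebraMap k _ c))
    (hf : ∀ a, P (fn 𝒜 a)) (hd : ∀ a, P (dfn 𝒜 a))
    (hadd : ∀ x y, P x → P y → P (x + y)) (hmul : ∀ x y, P x → P y → P (x * y))
    (x : Forms 𝒜) : P x := by
  obtain ⟨y, rfl⟩ := RingQuot.mkAlgHom_surjective k (FormRel 𝒜) x
  change P (mk 𝒜 y)
  induction y using FreeAlgebra.induction with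
  | grade0 c => simpa using hk c
  | grade1 s => rcases s with a | a; exacts [hf a, hd a]
  | mul a b ha hb => simpa using hmul _ _ ha hb
  | add a b ha hb => simpa using hadd _ _ ha hb

section lift

variable {B : Type u} [Ring B] [Algebra k B]

/-- The universal property of the de Rham algebra as an algebra. -/
def lift (f g : A → B)
    (h : ∀ ⦃x y⦄, FormRel 𝒜 x y →
      FreeAlgebra.lift k (Sum.elim f g) x = FreeAlgebra.lift k (Sum.elim f g) y) :
    Forms 𝒜 →ₐ[k] B :=
  RingQuot.liftAlgHom k ⟨FreeAlgebra.lift k (Sum.elim f g), h⟩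

theorem lift_fn (f g : A → B) (h) (a : A) : lift 𝒜 f g h (fn 𝒜 a) = f a := by
  refine (RingQuot.liftAlgHom_mkAlgHom_apply k _ h _).trans ?_
  simp

theorem lift_dfn (f g : A → B) (h) (a : A) : lift 𝒜 f g h (dfn 𝒜 a) = g a := by
  refine (RingQuot.liftAlgHom_mkAlgHom_apply k _ h _).trans ?_
  simp

end lift

/-- The sign automorphism: multiplication by `(-1) ^ n` on forms of degree `n`. -/
def eps : Forms 𝒜 →ₐ[k] Forms 𝒜 :=
  lift 𝒜 (fun a => fn 𝒜 a) (fun a => -dfn 𝒜 a) (by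
    intro x y h
    induction h with
    | fn_add a b => simp
    | fn_smul c a => simp
    | fn_one => simp [fn_one]
    | fn_mul a b => simp [fn_mul]
    | d_add a b => simp [add_comm]
    | d_smul c a => simp
    | d_mul a b => simp [dfn_mul, add_comm]
    | fn_d i j a b ha hb => simp [fn_dfn ha hb]
    | d_d i j a b ha hb => simp [dfn_dfn ha hb]
    | d_sq a ha => simp [dfn_sq ha])

theorem eps_fn (a : A) : eps 𝒜 (fn 𝒜 a) = fn 𝒜 a := lift_fn ..

theorem eps_dfn (a : A) : eps 𝒜 (dfn 𝒜 a) = -dfn 𝒜 a := lift_dfn ..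

/-- The algebra map `x ↦ (ε x, d x; 0, x)`, used to define `d`. -/
def dMat : Forms 𝒜 →ₐ[k] Matrix (Fin 2) (Fin 2) (Forms 𝒜) :=
  lift 𝒜 (fun a => !![fn 𝒜 a, dfn 𝒜 a; 0, fn 𝒜 a]) (fun a => !![-dfn 𝒜 a, 0; 0, dfn 𝒜 a]) (by
    intro x y h
    induction h with
    | fn_add a b => simp
    | fn_smul c a => simp
    | fn_one =>
      have h1 : dfn 𝒜 1 = 0 := by simpa [fn_one] using dfn_mul 𝒜 1 1
      simp [fn_one, h1, Matrix.one_fin_two]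
    | fn_mul a b => simp [fn_mul, dfn_mul, add_comm]
    | d_add a b => simp [add_comm]
    | d_smul c a => simp
    | d_mul a b => simp [dfn_mul, add_comm]
    | fn_d i j a b ha hb =>
      simp only [map_units_smul, map_mul, FreeAlgebra.lift_ι_apply, Sum.elim_inl, Sum.elim_inr]
      ext p q
      fin_cases p <;> fin_cases q <;>
        simp [Matrix.mul_apply, Fin.sum_univ_two, fn_dfn ha hb, dfn_dfn ha hb, uzpow_add]
    | d_d i j a b ha hb =>
      simp only [map_units_smul, map_mul, FreeAlgebra.lift_ι_apply, Sum.elim_inr]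
      ext p q
      fin_cases p <;> fin_cases q <;>
        simp [Matrix.mul_apply, Fin.sum_univ_two, dfn_dfn ha hb]
    | d_sq a ha => ext p q; fin_cases p <;> fin_cases q <;> simp [dfn_sq ha])

theorem dMat_fn (a : A) : dMat 𝒜 (fn 𝒜 a) = !![fn 𝒜 a, dfn 𝒜 a; 0, fn 𝒜 a] := lift_fn ..

theorem dMat_dfn (a : A) : dMat 𝒜 (dfn 𝒜 a) = !![-dfn 𝒜 a, 0; 0, dfn 𝒜 a] := lift_dfn ..

/-- The de Rham differential. It is characterized by `d (fn a) = dfn a`, `d (dfn a) = 0` and the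
Leibniz rule `d (x y) = d x y + (-1) ^ deg x x d y`, proved below. -/
def d : Forms 𝒜 →ₗ[k] Forms 𝒜 where
  toFun x := dMat 𝒜 x 0 1
  map_add' x y := by simp
  map_smul' c x := by simp

theorem dMat_diag (x : Forms 𝒜) :
    dMat 𝒜 x 0 0 = eps 𝒜 x ∧ dMat 𝒜 x 1 0 = 0 ∧ dMat 𝒜 x 1 1 = x := by
  induction x using induction with
  | hk c => simp [Matrix.algebraMap_matrix_apply]
  | hf a => simp [dMat_fn, eps_fn]
  | hd a => simp [dMat_dfn, eps_dfn]
  | hadd x y hx hy => simp [hx, hy]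
  | hmul x y hx hy => simp [Matrix.mul_apply, Fin.sum_univ_two, hx, hy]

theorem d_fn (a : A) : d 𝒜 (fn 𝒜 a) = dfn 𝒜 a := by simp [d, dMat_fn]

theorem d_dfn (a : A) : d 𝒜 (dfn 𝒜 a) = 0 := by simp [d, dMat_dfn]

theorem d_mul (x y : Forms 𝒜) : d 𝒜 (x * y) = d 𝒜 x * y + eps 𝒜 x * d 𝒜 y := by
  simp [d, Matrix.mul_apply, Fin.sum_univ_two, dMat_diag, add_comm]

theorem d_algebraMap (c : k) : d 𝒜 (algebraMap k _ c) = 0 := by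
  simp [d, Matrix.algebraMap_matrix_apply]

theorem d_one : d 𝒜 1 = 0 := by simpa using d_algebraMap 𝒜 1

theorem dfn_one : dfn 𝒜 1 = 0 := by simpa [fn_one] using dfn_mul 𝒜 1 1

theorem eps_d (x : Forms 𝒜) : eps 𝒜 (d 𝒜 x) = -d 𝒜 (eps 𝒜 x) := by
  induction x using induction with
  | hk c => simp [d_algebraMap]
  | hf a => simp [d_fn, eps_fn, eps_dfn]
  | hd a => simp [d_dfn, eps_dfn]
  | hadd x y hx hy => simp [hx, hy, add_comm]
  | hmul x y hx hy => simp [d_mul, hx, hy, add_comm]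

theorem d_d (x : Forms 𝒜) : d 𝒜 (d 𝒜 x) = 0 := by
  induction x using induction with
  | hk c => simp [d_algebraMap]
  | hf a => simp [d_fn, d_dfn]
  | hd a => simp [d_dfn]
  | hadd x y hx hy => simp [hx, hy]
  | hmul x y hx hy => simp [d_mul, hx, hy, eps_d]

/-! ### Degree and parity -/

/-- The forms of degree `n` and parity `p`: the span of the forms `a₀ da₁ ⋯ daₙ` with homogeneous
`a₀, …, aₙ` of total parity `p`. -/
def piece (n : ℕ) (p : ZMod 2) : Submodule k (Forms 𝒜) :=
  Submodule.span k {w | ∃ (a : Fin (n + 1) → A) (q : Fin (n + 1) → ZMod 2),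
    (∀ i, a i ∈ 𝒜 (q i)) ∧ ∑ i, q i = p ∧
      w = fn 𝒜 (a 0) * (List.ofFn fun i : Fin n => dfn 𝒜 (a i.succ)).prod}

theorem d_prod_dfn (l : List A) : d 𝒜 (l.map (dfn 𝒜)).prod = 0 := by
  induction l with
  | nil => simp [d_one]
  | cons a l ih => simp [d_mul, d_dfn, ih]

theorem d_piece (h : (1 : A) ∈ 𝒜 0) (n : ℕ) (p : ZMod 2) (x : Forms 𝒜) (hx : x ∈ piece 𝒜 n p) :
    d 𝒜 x ∈ piece 𝒜 (n + 1) p := by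
  induction hx using Submodule.span_induction with
  | zero => simp
  | add x y _ _ hx hy => simpa using add_mem hx hy
  | smul c x _ hx => simpa using Submodule.smul_mem _ c hx
  | mem w hw =>
    obtain ⟨a, q, ha, hq, rfl⟩ := hw
    refine Submodule.subset_span ⟨Fin.cons 1 a, Fin.cons 0 q, ?_, ?_, ?_⟩
    · intro i
      refine Fin.cases ?_ (fun i => ?_) i <;> simp [h, ha]
    · rw [Fin.sum_univ_succ]; simp [hq]
    · have := d_prod_dfn 𝒜 (List.ofFn fun i : Fin n => a i.succ)
      rw [List.map_ofFn] at this
      rw [d_mul, d_fn]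
      simp only [Function.comp_def] at this
      simp [this, fn_one, List.ofFn_succ]

/-! ### The filtration -/

/-- The ideal of `A` generated by the odd elements. -/
def oddIdeal : Submodule k A := ⊤ * 𝒜 1 * ⊤

/-- The `i`-th step of the filtration of `Ω^•_A`: the ideal generated by
`N ^ i, N ^ (i - 1) dN, …, (dN) ^ i`, where `N` is the ideal of `A` generated by odd elements. -/
def filt (i : ℕ) : Submodule k (Forms 𝒜) :=
  ⊤ * (⨆ j ∈ Finset.range (i + 1),
    (oddIdeal 𝒜).map (fn 𝒜) ^ (i - j) * (oddIdeal 𝒜).map (dfn 𝒜) ^ j) * ⊤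

theorem filt_zero : filt 𝒜 0 = ⊤ := by
  refine top_le_iff.mp fun x _ => ?_
  have : x = x * 1 * 1 := by simp
  rw [this]
  refine Submodule.mul_mem_mul (Submodule.mul_mem_mul trivial ?_) trivial
  simpa using (Submodule.one_le (P := (1 : Submodule k (Forms 𝒜)))).mp le_rfl

variable {𝒜}

theorem _root_.SuperGeom.IsSuperalgebra.mem_span (h : IsSuperalgebra 𝒜) (a : A) :
    a ∈ Submodule.span k {x | ∃ i, x ∈ 𝒜 i} := by
  have h1 : a ∈ iSup 𝒜 := by rw [h.internal.submodule_iSup_eq_top]; trivial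
  refine (iSup_le fun i => ?_ : iSup 𝒜 ≤ _) h1
  exact fun x hx => Submodule.subset_span ⟨i, hx⟩

theorem oddIdeal_homogeneous (h : IsSuperalgebra 𝒜) :
    oddIdeal 𝒜 = Submodule.span k {x | x ∈ oddIdeal 𝒜 ∧ ∃ i, x ∈ 𝒜 i} := by
  refine le_antisymm ?_ (Submodule.span_le.mpr fun x hx => hx.1)
  have htop : (⊤ : Submodule k A) = Submodule.span k {x | ∃ i, x ∈ 𝒜 i} :=
    (top_le_iff.mp fun a _ => h.mem_span a).symm
  have hodd : 𝒜 1 = Submodule.span k (𝒜 1 : Set A) := (Submodule.span_eq _).symm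
  conv_lhs => rw [oddIdeal, htop, hodd, Submodule.span_mul_span, Submodule.span_mul_span]
  refine Submodule.span_mono ?_
  rintro _ ⟨_, ⟨a, ⟨i, ha⟩, b, hb, rfl⟩, c, ⟨j, hc⟩, rfl⟩
  refine ⟨Submodule.mul_mem_mul (Submodule.mul_mem_mul trivial hb) trivial, i + 1 + j, ?_⟩
  exact h.mul_mem _ _ _ _ (h.mul_mem _ _ _ _ ha hb) hc

theorem units_smul_mem (S : Submodule k (Forms 𝒜)) (e : ℤˣ) {x : Forms 𝒜} (hx : x ∈ S) :
    e • x ∈ S := by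
  rw [Units.smul_def]; exact zsmul_mem hx _

theorem commute_odd (h : IsSuperalgebra 𝒜) :
    Commute ((oddIdeal 𝒜).map (fn 𝒜)) ((oddIdeal 𝒜).map (dfn 𝒜)) := by
  set S := {x | x ∈ oddIdeal 𝒜 ∧ ∃ i, x ∈ 𝒜 i} with hS
  have e1 : (oddIdeal 𝒜).map (fn 𝒜) = Submodule.span k (fn 𝒜 '' S) := by
    rw [oddIdeal_homogeneous h, Submodule.map_span]
  have e2 : (oddIdeal 𝒜).map (dfn 𝒜) = Submodule.span k (dfn 𝒜 '' S) := by
    rw [oddIdeal_homogeneous h, Submodule.map_span]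
  rw [Commute, SemiconjBy, e1, e2, Submodule.span_mul_span, Submodule.span_mul_span]
  refine le_antisymm (Submodule.span_le.mpr ?_) (Submodule.span_le.mpr ?_)
  · rintro _ ⟨_, ⟨a, ha, rfl⟩, _, ⟨b, hb, rfl⟩, rfl⟩
    obtain ⟨i, hi⟩ := ha.2
    obtain ⟨j, hj⟩ := hb.2
    change fn 𝒜 a * dfn 𝒜 b ∈ _
    rw [fn_dfn hi hj]
    exact units_smul_mem _ _ (Submodule.subset_span ⟨_, ⟨b, hb, rfl⟩, _, ⟨a, ha, rfl⟩, rfl⟩)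
  · rintro _ ⟨_, ⟨b, hb, rfl⟩, _, ⟨a, ha, rfl⟩, rfl⟩
    obtain ⟨i, hi⟩ := ha.2
    obtain ⟨j, hj⟩ := hb.2
    have : dfn 𝒜 b * fn 𝒜 a = ((-1 : ℤˣ) ^ (i * j)) • (fn 𝒜 a * dfn 𝒜 b) := by
      rw [fn_dfn hi hj, smul_smul]
      simp
    change dfn 𝒜 b * fn 𝒜 a ∈ _
    rw [this]
    exact units_smul_mem _ _ (Submodule.subset_span ⟨_, ⟨a, ha, rfl⟩, _, ⟨b, hb, rfl⟩, rfl⟩)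

theorem add_pow_of_commute {P Q : Submodule k (Forms 𝒜)} (h : Commute P Q) (i : ℕ) :
    (P ⊔ Q) ^ i = ⨆ j ∈ Finset.range (i + 1), P ^ (i - j) * Q ^ j := by
  apply le_antisymm
  · induction i with
    | zero => simp
    | succ i ih =>
      rw [pow_succ']
      refine (mul_le_mul_right ih _).trans ?_
      simp only [Submodule.mul_iSup, iSup_le_iff, Finset.mem_range]
      intro j hj
      rw [Submodule.sup_mul, sup_le_iff]
      constructor
      · rw [← mul_assoc, ← pow_succ']
        refine le_iSup₂_of_le j (by simp; omega) ?_
        rw [show i + 1 - j = i - j + 1 by omega]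
      · rw [← mul_assoc, ((h.pow_left (i - j)).eq).symm, mul_assoc, ← pow_succ']
        refine le_iSup₂_of_le (j + 1) (by simp; omega) ?_
        rw [show i + 1 - (j + 1) = i - j by omega]
  · simp only [iSup_le_iff, Finset.mem_range]
    intro j hj
    calc P ^ (i - j) * Q ^ j ≤ (P ⊔ Q) ^ (i - j) * (P ⊔ Q) ^ j :=
          mul_le_mul' (pow_le_pow_left' le_sup_left _)
            (pow_le_pow_left' le_sup_right _)
      _ = (P ⊔ Q) ^ i := by rw [← pow_add]; congr 1; omega

theorem filt_eq (h : IsSuperalgebra 𝒜) (i : ℕ) :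
    filt 𝒜 i = ⊤ * ((oddIdeal 𝒜).map (fn 𝒜) ⊔ (oddIdeal 𝒜).map (dfn 𝒜)) ^ i * ⊤ := by
  rw [add_pow_of_commute (commute_odd h), filt]

theorem d_filt (h : IsSuperalgebra 𝒜) (i : ℕ) (x : Forms 𝒜) (hx : x ∈ filt 𝒜 i) :
    d 𝒜 x ∈ filt 𝒜 i := by
  rw [filt_eq h] at hx ⊢
  set S := (oddIdeal 𝒜).map (fn 𝒜) ⊔ (oddIdeal 𝒜).map (dfn 𝒜) with hS
  have base : ∀ y ∈ S, d 𝒜 y ∈ S ∧ eps 𝒜 y ∈ S := by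
    intro y hy
    obtain ⟨_, ⟨a, ha, rfl⟩, _, ⟨b, hb, rfl⟩, rfl⟩ := Submodule.mem_sup.mp hy
    have h1 : fn 𝒜 a ∈ S := Submodule.mem_sup_left ⟨a, ha, rfl⟩
    have h2 : dfn 𝒜 a ∈ S := Submodule.mem_sup_right ⟨a, ha, rfl⟩
    have h3 : dfn 𝒜 b ∈ S := Submodule.mem_sup_right ⟨b, hb, rfl⟩
    simp only [map_add, d_fn, d_dfn, eps_fn, eps_dfn, add_zero]
    exact ⟨h2, add_mem h1 (neg_mem h3)⟩
  have mul : ∀ P Q : Submodule k (Forms 𝒜), (∀ y ∈ P, d 𝒜 y ∈ P ∧ eps 𝒜 y ∈ P) →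
      (∀ y ∈ Q, d 𝒜 y ∈ Q ∧ eps 𝒜 y ∈ Q) → ∀ y ∈ P * Q, d 𝒜 y ∈ P * Q ∧ eps 𝒜 y ∈ P * Q := by
    intro P Q hP hQ y hy
    induction hy using Submodule.mul_induction_on' with
    | mem_mul_mem a ha b hb =>
      rw [d_mul, map_mul]
      exact ⟨add_mem (Submodule.mul_mem_mul (hP a ha).1 hb)
        (Submodule.mul_mem_mul (hP a ha).2 (hQ b hb).1),
        Submodule.mul_mem_mul (hP a ha).2 (hQ b hb).2⟩
    | add x _ y _ hx hy =>
      rw [map_add, map_add]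
      exact ⟨add_mem hx.1 hy.1, add_mem hx.2 hy.2⟩
  have pow : ∀ i : ℕ, ∀ y ∈ S ^ i, d 𝒜 y ∈ S ^ i ∧ eps 𝒜 y ∈ S ^ i := by
    intro i
    induction i with
    | zero =>
      intro y hy
      rw [pow_zero] at hy ⊢
      obtain ⟨c, rfl⟩ := Submodule.mem_one.mp hy
      exact ⟨by simp [d_algebraMap], by simp⟩
    | succ i ih => rw [pow_succ]; exact mul _ _ ih base
  exact (mul _ _ (mul _ _ (fun _ _ => ⟨Submodule.mem_top, Submodule.mem_top⟩) (pow i))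
    (fun _ _ => ⟨Submodule.mem_top, Submodule.mem_top⟩) x hx).1

/-- Forms of degree `n` and parity `p` in the `i`-th step of the filtration. -/
def filtPiece (𝒜 : ZMod 2 → Submodule k A) (i n : ℕ) (p : ZMod 2) : Submodule k (Forms 𝒜) :=
  filt 𝒜 i ⊓ piece 𝒜 n p

/-- The de Rham differential on the pieces. -/
def dPiece (h : IsSuperalgebra 𝒜) (i n : ℕ) (p : ZMod 2) :
    filtPiece 𝒜 i n p →ₗ[k] filtPiece 𝒜 i (n + 1) p :=
  (d 𝒜).restrict fun x hx => ⟨d_filt h i x hx.1, d_piece 𝒜 h.one_mem n p x hx.2⟩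

end Algebra

/-! ### Functoriality -/

section Functoriality

variable {k A B C : Type u} [Field k] [Ring A] [Algebra k A] [Ring B] [Algebra k B]
  [Ring C] [Algebra k C]
  {𝒜 : ZMod 2 → Submodule k A} {ℬ : ZMod 2 → Submodule k B} {𝒞 : ZMod 2 → Submodule k C}

/-- The map of de Rham algebras induced by a homomorphism of superalgebras. -/
def map (f : A →ₐ[k] B) (hf : ∀ i, ∀ a ∈ 𝒜 i, f a ∈ ℬ i) : Forms 𝒜 →ₐ[k] Forms ℬ :=
  lift 𝒜 (fun a => fn ℬ (f a)) (fun a => dfn ℬ (f a)) (by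
    intro x y h
    induction h with
    | fn_add a b => simp
    | fn_smul c a => simp
    | fn_one => simp [fn_one]
    | fn_mul a b => simp [fn_mul]
    | d_add a b => simp
    | d_smul c a => simp
    | d_mul a b => simp [dfn_mul]
    | fn_d i j a b ha hb => simp [fn_dfn (hf i a ha) (hf j b hb)]
    | d_d i j a b ha hb => simp [dfn_dfn (hf i a ha) (hf j b hb)]
    | d_sq a ha => simp [dfn_sq (hf 0 a ha)])

theorem map_fn (f : A →ₐ[k] B) (hf : ∀ i, ∀ a ∈ 𝒜 i, f a ∈ ℬ i) (a : A) :
    map f hf (fn 𝒜 a) = fn ℬ (f a) := lift_fn ..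

theorem map_dfn (f : A →ₐ[k] B) (hf : ∀ i, ∀ a ∈ 𝒜 i, f a ∈ ℬ i) (a : A) :
    map f hf (dfn 𝒜 a) = dfn ℬ (f a) := lift_dfn ..

theorem map_eps (f : A →ₐ[k] B) (hf : ∀ i, ∀ a ∈ 𝒜 i, f a ∈ ℬ i) (x : Forms 𝒜) :
    map f hf (eps 𝒜 x) = eps ℬ (map f hf x) := by
  induction x using induction with
  | hk c => simp
  | hf a => simp [map_fn, eps_fn]
  | hd a => simp [map_dfn, eps_dfn]
  | hadd x y hx hy => simp [hx, hy]
  | hmul x y hx hy => simp [hx, hy]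

theorem map_d (f : A →ₐ[k] B) (hf : ∀ i, ∀ a ∈ 𝒜 i, f a ∈ ℬ i) (x : Forms 𝒜) :
    map f hf (d 𝒜 x) = d ℬ (map f hf x) := by
  induction x using induction with
  | hk c => simp [d_algebraMap]
  | hf a => simp [map_fn, map_dfn, d_fn]
  | hd a => simp [map_dfn, d_dfn]
  | hadd x y hx hy => simp [hx, hy]
  | hmul x y hx hy => simp [hx, hy, d_mul, map_eps]

theorem map_id_apply (hf : ∀ i, ∀ a ∈ 𝒜 i, AlgHom.id k A a ∈ 𝒜 i) (x : Forms 𝒜) :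
    map (AlgHom.id k A) hf x = x := by
  induction x using induction with
  | hk c => simp
  | hf a => simp [map_fn]
  | hd a => simp [map_dfn]
  | hadd x y hx hy => simp [hx, hy]
  | hmul x y hx hy => simp [hx, hy]

theorem map_comp_apply (f : A →ₐ[k] B) (hf : ∀ i, ∀ a ∈ 𝒜 i, f a ∈ ℬ i) (g : B →ₐ[k] C)
    (hg : ∀ i, ∀ a ∈ ℬ i, g a ∈ 𝒞 i) (hgf : ∀ i, ∀ a ∈ 𝒜 i, g.comp f a ∈ 𝒞 i) (x : Forms 𝒜) :
    map (g.comp f) hgf x = map g hg (map f hf x) := by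
  induction x using induction with
  | hk c => simp
  | hf a => simp [map_fn]
  | hd a => simp [map_dfn]
  | hadd x y hx hy => simp [hx, hy]
  | hmul x y hx hy => simp [hx, hy]

theorem map_piece (f : A →ₐ[k] B) (hf : ∀ i, ∀ a ∈ 𝒜 i, f a ∈ ℬ i) (n : ℕ) (p : ZMod 2)
    (x : Forms 𝒜) (hx : x ∈ piece 𝒜 n p) : map f hf x ∈ piece ℬ n p := by
  induction hx using Submodule.span_induction with
  | zero => simp
  | add x y _ _ hx hy => simpa using add_mem hx hy
  | smul c x _ hx => simpa using Submodule.smul_mem _ c hx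
  | mem w hw =>
    obtain ⟨a, q, ha, hq, rfl⟩ := hw
    refine Submodule.subset_span ⟨f ∘ a, q, fun i => hf _ _ (ha i), hq, ?_⟩
    simp [map_fn, map_list_prod, List.map_ofFn, Function.comp_def, map_dfn]

theorem map_filt (f : A →ₐ[k] B) (hf : ∀ i, ∀ a ∈ 𝒜 i, f a ∈ ℬ i) (i : ℕ)
    (x : Forms 𝒜) (hx : x ∈ filt 𝒜 i) : map f hf x ∈ filt ℬ i := by
  have hN : (oddIdeal 𝒜).map f.toLinearMap ≤ oddIdeal ℬ := by
    rw [oddIdeal, oddIdeal, Submodule.map_mul, Submodule.map_mul]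
    refine mul_le_mul' (mul_le_mul' le_top ?_) le_top
    rintro _ ⟨a, ha, rfl⟩
    exact hf 1 a ha
  have h1 : ((oddIdeal 𝒜).map (fn 𝒜)).map (map f hf).toLinearMap ≤
      (oddIdeal ℬ).map (fn ℬ) := by
    rintro _ ⟨_, ⟨a, ha, rfl⟩, rfl⟩
    exact ⟨f a, hN ⟨a, ha, rfl⟩, (map_fn f hf a).symm⟩
  have h2 : ((oddIdeal 𝒜).map (dfn 𝒜)).map (map f hf).toLinearMap ≤
      (oddIdeal ℬ).map (dfn ℬ) := by
    rintro _ ⟨_, ⟨a, ha, rfl⟩, rfl⟩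
    exact ⟨f a, hN ⟨a, ha, rfl⟩, (map_dfn f hf a).symm⟩
  have h3 : (filt 𝒜 i).map (map f hf).toLinearMap ≤ filt ℬ i := by
    rw [filt, filt, Submodule.map_mul, Submodule.map_mul]
    refine mul_le_mul' (mul_le_mul' le_top ?_) le_top
    simp only [Submodule.map_iSup]
    refine iSup₂_mono fun j _ => ?_
    rw [Submodule.map_mul, Submodule.map_pow, Submodule.map_pow]
    exact mul_le_mul' (pow_le_pow_left' h1 _)
      (pow_le_pow_left' h2 _)
  exact h3 ⟨x, hx, rfl⟩

/-- The induced map on pieces. -/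
def mapPiece (f : A →ₐ[k] B) (hf : ∀ i, ∀ a ∈ 𝒜 i, f a ∈ ℬ i) (i n : ℕ) (p : ZMod 2) :
    filtPiece 𝒜 i n p →ₗ[k] filtPiece ℬ i n p :=
  (map f hf).toLinearMap.restrict fun x hx =>
    ⟨map_filt f hf i x hx.1, map_piece f hf n p x hx.2⟩

end Functoriality

end Forms

/-! ### Superspaces -/

/-- A superspace over `k`: a topological space with a sheaf of supercommutative
`k`-superalgebras. -/
structure Superspace (k : Type u) [Field k] extends SheafedSpace.{u + 1, u, u} (AlgCat.{u} k) where
  /-- The even and odd sections over an open subset. -/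
  part : ∀ U : Opens carrier, ZMod 2 → Submodule k (presheaf.obj (op U))
  isSuperalgebra : ∀ U, IsSuperalgebra (part U)
  res_mem : ∀ {U V : (Opens carrier)ᵒᵖ} (f : U ⟶ V) (i : ZMod 2),
    ∀ a ∈ part U.unop i, (presheaf.map f).hom a ∈ part V.unop i

namespace Superspace

variable {k : Type u} [Field k] (X : Superspace k)

/-- The presheaf `U ↦ (F^i Ω^n)_p` of the algebras of sections of `𝒪_X`. -/
def formsPresheaf (i n : ℕ) (p : ZMod 2) : (Opens X.carrier)ᵒᵖ ⥤ ModuleCat.{u} k where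
  obj U := ModuleCat.of k (Forms.filtPiece (X.part U.unop) i n p)
  map {U V} f := ModuleCat.ofHom (Forms.mapPiece (X.presheaf.map f).hom (X.res_mem f) i n p)
  map_id U := by
    ext x
    change Forms.map (X.presheaf.map (𝟙 U)).hom _ x.1 = x.1
    have h : (X.presheaf.map (𝟙 U)).hom = AlgHom.id k _ := by simp
    rw! [h]
    exact Forms.map_id_apply _ _
  map_comp {U V W} f g := by
    ext x
    change Forms.map (X.presheaf.map (f ≫ g)).hom _ x.1 =
      Forms.map (X.presheaf.map g).hom _ (Forms.map (X.presheaf.map f).hom _ x.1)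
    have h : (X.presheaf.map (f ≫ g)).hom =
      (X.presheaf.map g).hom.comp (X.presheaf.map f).hom := by simp
    rw! [h]
    exact Forms.map_comp_apply _ _ _ _ _ _

/-- The presheaf version of the complex `(F^i Ω^•_X)_p`. -/
def deRhamPresheaf (i : ℕ) (p : ZMod 2) :
    CochainComplex ((Opens X.carrier)ᵒᵖ ⥤ ModuleCat.{u} k) ℕ :=
  CochainComplex.of (fun n => X.formsPresheaf i n p)
    (fun n =>
      { app := fun U => ModuleCat.ofHom (Forms.dPiece (X.isSuperalgebra U.unop) i n p)
        naturality := fun U V f => by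
          ext x
          exact Subtype.ext (Forms.map_d _ _ _).symm })
    (fun n => by
      ext U x
      exact Subtype.ext (Forms.d_d _ _))

/-- The part of parity `p` of the `i`-th step `F^i Ω^•_X` of the filtration of the de Rham complex
of `X`, as a complex of sheaves of `k`-vector spaces on `X`. The sheaf `Ω^n_X` is associated with
the presheaf `U ↦ Ω^n_{𝒪(U)}`, and since sheafification is exact, the subsheaf `(F^i Ω^n_X)_p` is
associated with the presheaf `U ↦ (F^i Ω^n_{𝒪(U)})_p`. -/
def filteredDeRham (i : ℕ) (p : ZMod 2) :
    CochainComplex (Sheaf (Opens.grothendieckTopology X.carrier) (ModuleCat.{u} k)) ℕ :=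
  ((presheafToSheaf (Opens.grothendieckTopology X.carrier)
    (ModuleCat.{u} k)).mapHomologicalComplex _).obj (X.deRhamPresheaf i p)

/-- The part `(Ω^•_X)_p` of parity `p` of the de Rham complex of `X`; note that `F^0 Ω^•` is all of
`Ω^•`, see `Forms.filt_zero`. -/
def deRham (p : ZMod 2) :
    CochainComplex (Sheaf (Opens.grothendieckTopology X.carrier) (ModuleCat.{u} k)) ℕ :=
  X.filteredDeRham 0 p

/-- An open chart of `X` of dimension `n|m`: an isomorphism of the superscheme
`(Z, ⋀ (𝒪_Z ^ m))`, where `Z` is a smooth `k`-scheme of dimension `n`, with an open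
subspace of `X`. -/
structure Chart (n m : ℕ) where
  /-- The underlying even scheme of the chart. -/
  Z : Scheme.{u}
  /-- The structure morphism of the `k`-scheme `Z`. -/
  str : Z ⟶ Spec (CommRingCat.of k)
  smooth : SmoothOfRelativeDimension n str
  /-- The map of the underlying topological spaces. -/
  f : Z.toPresheafedSpace.carrier ⟶ X.carrier
  isOpenEmbedding : Topology.IsOpenEmbedding f
  /-- The even coordinate functions: a homomorphism of sheaves of algebras from `𝒪_Z` to the
  even part of `𝒪_X`. -/
  σ : ∀ W : Z.Opens,
    Γ(Z, W) →+* X.presheaf.obj (op ((IsOpenMap.functor (f := f) isOpenEmbedding.isOpenMap).obj W))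
  σ_even : ∀ (W : Z.Opens) (s : Γ(Z, W)), σ W s ∈ X.part _ 0
  σ_res : ∀ (W W' : Z.Opens) (h : W' ⟶ W) (s : Γ(Z, W)),
    (X.presheaf.map ((IsOpenMap.functor (f := f) isOpenEmbedding.isOpenMap).map h).op).hom (σ W s) =
      σ W' (Z.presheaf.map h.op s)
  σ_algebraMap : ∀ c : k,
    σ ⊤ (str.appTop ((Scheme.ΓSpecIso (CommRingCat.of k)).inv c)) = algebraMap k _ c
  /-- The odd coordinate functions. -/
  θ : Fin m → X.presheaf.obj (op ((IsOpenMap.functor (f := f) isOpenEmbedding.isOpenMap).obj ⊤))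
  θ_odd : ∀ i, θ i ∈ X.part _ 1
  /-- Over each open subset `W` of `Z`, each section of `𝒪_X` is uniquely of the form
  `∑ σ(s_I) θ_I`, where `I = {i₁ < ⋯ < i_r}` runs over the subsets of `{1, …, m}` and
  `θ_I = θ_{i₁} ⋯ θ_{i_r}`. -/
  bijective : ∀ W : Z.Opens, Function.Bijective fun s : Finset (Fin m) → Γ(Z, W) =>
    ∑ I, σ W (s I) * (X.presheaf.map
      ((IsOpenMap.functor (f := f) isOpenEmbedding.isOpenMap).map (homOfLE (le_top : W ≤ ⊤))).op).hom
        ((I.sort (· ≤ ·)).map θ).prod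

/-- `X` is a smooth superscheme over `k` of dimension `n|m`: it is locally isomorphic to
`(Z, ⋀ (𝒪_Z ^ m))` for smooth `k`-schemes `Z` of dimension `n`. -/
def IsSmoothOfDimension (n m : ℕ) : Prop :=
  ∀ x : X.carrier, ∃ c : X.Chart n m, x ∈ Set.range c.f

end Superspace

end SuperGeom

end

/-!
Over a chart, `X` has functions `A = R[θ, η]`, which are graded by their degree `0`, `1`, `2` in
the odd coordinates. Let `E` be the Euler vector field of this grading, `ι` the contraction with
`E` and `L = d ι + ι d` the Lie derivative. `L` multiplies forms of weight `w` by `w`, hence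
`h = ι L⁻¹` is a homotopy between the identity and zero on forms of positive weight
(`SuperGeom.WeightGrading.d_homotopy`). Odd forms and forms in `F^1` have positive weight.

The grading and `E` depend on the choice of the coordinates and need not exist globally. The
homotopy `h` does not depend on this choice, and this is the point of the proof
(`SuperGeom.WeightGrading.map_homotopy`). Let `N` be the ideal generated by the odd functions, so
that `N ^ 3 = 0` in odd dimension two. Two Euler vector fields `E` and `E'` agree on odd functions
and map even functions to `N ^ 2`, so `ι' - ι` takes values in `N ^ 2 Ω`; it is linear over
functions, and `ι` takes values in `N Ω`. Together with `ι ι = 0` this yields `ι' ι = 0` and so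
`h' h = 0`. On forms of positive weight, `h' = h' (d h + h d) = h' d h = (d h' + h' d) h = h`.

The local homotopies are thus compatible with restriction among the open subsets that carry a
weight grading. These form a base of the topology, so the homotopies extend to the associated
sheaves (`SuperGeom.nonempty_homotopy_of_base`).
-/

noncomputable section

namespace SuperGeom

open Polynomial

/-! ### Weight gradings -/

/-- A linear map applied to each coefficient of a polynomial. -/
def coeffwise {k A B : Type*} [Field k] [Ring A] [Algebra k A] [Ring B] [Algebra k B]
    (f : A →ₗ[k] B) : A[X] →ₗ[k] B[X] :=
  Polynomial.lsum fun w => ((Polynomial.monomial w : B →ₗ[B] B[X]).restrictScalars k) ∘ₗ f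

theorem coeff_coeffwise {k A B : Type*} [Field k] [Ring A] [Algebra k A] [Ring B] [Algebra k B]
    (f : A →ₗ[k] B) (p : A[X]) (w : ℕ) : (coeffwise f p).coeff w = f (p.coeff w) := by
  induction p using Polynomial.induction_on' with
  | add p q hp hq => simp [hp, hq]
  | monomial n a =>
    have : coeffwise f (monomial n a) = monomial n (f a) := by
      simp [coeffwise, Polynomial.lsum, Polynomial.sum_monomial_index]
    rw [this, coeff_monomial, coeff_monomial]
    split_ifs <;> simp

/-- A grading of a superalgebra by weights `w : ℕ`, encoded by the algebra homomorphism `φ` that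
sends an element `a` with components `a_w` to the polynomial `∑ a_w X ^ w`. Odd elements have
weight `1`, and the components of positive weight of an even element lie in the square of the ideal
generated by the odd elements. -/
structure WeightGrading {k A : Type u} [Field k] [Ring A] [Algebra k A]
    (𝒜 : ZMod 2 → Submodule k A) where
  isSuperalgebra : IsSuperalgebra 𝒜
  /-- The coaction `a ↦ ∑ a_w X ^ w`. -/
  φ : A →ₐ[k] A[X]
  coeff_mem : ∀ {i : ZMod 2} {a : A}, a ∈ 𝒜 i → ∀ w, (φ a).coeff w ∈ 𝒜 i
  eval_one : ∀ a, (φ a).eval 1 = a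
  φ_coeff : ∀ a w, φ ((φ a).coeff w) = monomial w ((φ a).coeff w)
  φ_odd : ∀ a ∈ 𝒜 1, φ a = monomial 1 a
  coeff_even : ∀ a ∈ 𝒜 0, ∀ w, (φ a).coeff (w + 1) ∈ Forms.oddIdeal 𝒜 * Forms.oddIdeal 𝒜

theorem sum_antidiagonal_swap_smul {B : Type*} [Ring B] (f g : ℕ → ℕ → B) (e : ℤˣ)
    (h : ∀ i j, f i j = e • g j i) (w : ℕ) :
    ∑ x ∈ Finset.HasAntidiagonal.antidiagonal w, f x.1 x.2 =
      e • ∑ x ∈ Finset.HasAntidiagonal.antidiagonal w, g x.1 x.2 := by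
  rw [← Finset.Nat.sum_antidiagonal_swap, Finset.smul_sum]
  exact Finset.sum_congr rfl fun x _ => h _ _

theorem eval_one_mul {B : Type*} [Ring B] (p q : B[X]) :
    (p * q).eval 1 = p.eval 1 * q.eval 1 :=
  eval₂_mul_noncomm _ _ fun _ => Commute.one_right _

theorem coeff_units_smul {B : Type*} [Ring B] (e : ℤˣ) (p : B[X]) (w : ℕ) :
    (e • p).coeff w = e • p.coeff w := by
  rcases Int.units_eq_one_or e with rfl | rfl <;> simp

theorem map_intUnits_smul {M N : Type*} [AddCommGroup M] [AddCommGroup N] {k : Type*} [Ring k]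
    [Module k M] [Module k N] (f : M →ₗ[k] N) (e : ℤˣ) (x : M) : f (e • x) = e • f x := by
  rw [Units.smul_def, Units.smul_def, map_zsmul]

namespace WeightGrading

variable {k A : Type u} [Field k] [Ring A] [Algebra k A]
  {𝒜 : ZMod 2 → Submodule k A} (G : WeightGrading 𝒜)

/-- The Euler vector field: the derivation of `A` that multiplies elements of weight `w` by `w`. -/
def euler : A →ₗ[k] A where
  toFun a := (derivative (G.φ a)).eval 1
  map_add' a b := by simp
  map_smul' c a := by simp

/-- The Euler vector field is diagonal with respect to the weight decomposition. -/
theorem euler_coeff (a : A) (w : ℕ) : G.euler ((G.φ a).coeff w) = w • (G.φ a).coeff w := by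
  simp [euler, G.φ_coeff, derivative_monomial]
  rw [Nat.cast_comm]

theorem euler_eq_sum (a : A) :
    G.euler a = ∑ w ∈ Finset.range ((derivative (G.φ a)).natDegree + 1),
      (w + 1) • (G.φ a).coeff (w + 1) := by
  change (derivative (G.φ a)).eval 1 = _
  rw [eval_eq_sum_range]
  refine Finset.sum_congr rfl fun w _ => ?_
  rw [coeff_derivative, one_pow, mul_one, ← Nat.cast_succ, ← Nat.cast_comm, ← nsmul_eq_mul]

theorem euler_mem {i : ZMod 2} {a : A} (ha : a ∈ 𝒜 i) : G.euler a ∈ 𝒜 i := by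
  rw [euler_eq_sum]
  exact sum_mem fun w _ => nsmul_mem (G.coeff_mem ha _) _

theorem euler_mul (a b : A) : G.euler (a * b) = G.euler a * b + a * G.euler b := by
  simp only [euler, LinearMap.coe_mk, AddHom.coe_mk, map_mul, derivative_mul, eval_add,
    eval_one_mul, G.eval_one]

theorem euler_odd {a : A} (ha : a ∈ 𝒜 1) : G.euler a = a := by
  simp [euler, G.φ_odd a ha]

theorem euler_even {a : A} (ha : a ∈ 𝒜 0) :
    G.euler a ∈ Forms.oddIdeal 𝒜 * Forms.oddIdeal 𝒜 := by
  rw [euler_eq_sum]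
  exact sum_mem fun w _ => nsmul_mem (G.coeff_even a ha _) _

theorem coeff_euler (a : A) (w : ℕ) : (G.φ (G.euler a)).coeff w = w • (G.φ a).coeff w := by
  have h : ∀ a, G.φ a = ∑ w ∈ (G.φ a).support, monomial w ((G.φ a).coeff w) := fun a =>
    (G.φ a).as_sum_support
  have h2 : G.euler a = ∑ w ∈ (G.φ a).support, w • (G.φ a).coeff w := by
    conv_lhs => rw [← G.eval_one a, h a]
    simp [eval_finsetSum, euler_coeff]
  rw [h2, map_sum, finsetSum_coeff]
  simp only [map_nsmul, φ_coeff, coeff_smul, coeff_monomial]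
  simp
  intro h
  simp [h]

/-! ### Contraction with the Euler vector field -/

open Forms

/-- The algebra map `x ↦ (ε x, ι x; 0, x)`, used to define the contraction `ι`. -/
def iotaMat : Forms 𝒜 →ₐ[k] Matrix (Fin 2) (Fin 2) (Forms 𝒜) :=
  lift 𝒜 (fun a => !![fn 𝒜 a, 0; 0, fn 𝒜 a])
    (fun a => !![-dfn 𝒜 a, fn 𝒜 (G.euler a); 0, dfn 𝒜 a])
    (by
    intro x y h
    induction h with
    | fn_add a b => simp
    | fn_smul c a => simp
    | fn_one => simp [fn_one, Matrix.one_fin_two]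
    | fn_mul a b => simp [fn_mul]
    | d_add a b => simp [add_comm]
    | d_smul c a => simp
    | d_mul a b => simp [dfn_mul, add_comm, euler_mul, fn_mul]
    | fn_d i j a b ha hb =>
      have h0 : fn 𝒜 a * fn 𝒜 (G.euler b) =
          ((-1 : ℤˣ) ^ (i * j)) • (fn 𝒜 (G.euler b) * fn 𝒜 a) := by
        rw [← fn_mul, G.isSuperalgebra.comm i j a _ ha (G.euler_mem hb), map_intUnits_smul, fn_mul]
      simp only [map_units_smul, map_mul, FreeAlgebra.lift_ι_apply, Sum.elim_inl, Sum.elim_inr]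
      ext p q
      fin_cases p <;> fin_cases q <;>
        simp [Matrix.mul_apply, Fin.sum_univ_two, fn_dfn ha hb, h0]
    | d_d i j a b ha hb =>
      simp only [map_units_smul, map_mul, FreeAlgebra.lift_ι_apply, Sum.elim_inr]
      ext p q
      fin_cases p <;> fin_cases q <;>
        simp [Matrix.mul_apply, Fin.sum_univ_two, dfn_dfn ha hb]
      rw [fn_dfn (G.euler_mem ha) hb, fn_dfn (G.euler_mem hb) ha, mul_comm j i, uzpow_add]
      rcases Int.units_eq_one_or ((-1 : ℤˣ) ^ (i * j)) with h | h <;> simp [h, add_comm]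
    | d_sq a ha =>
      ext p q
      fin_cases p <;> fin_cases q <;> simp [dfn_sq ha]
      rw [fn_dfn (G.euler_mem ha) ha]
      simp)

theorem iotaMat_fn (a : A) : G.iotaMat (fn 𝒜 a) = !![fn 𝒜 a, 0; 0, fn 𝒜 a] := lift_fn ..

theorem iotaMat_dfn (a : A) :
    G.iotaMat (dfn 𝒜 a) = !![-dfn 𝒜 a, fn 𝒜 (G.euler a); 0, dfn 𝒜 a] := lift_dfn ..

/-- The contraction of forms with the Euler vector field: the skew derivation that vanishes on
functions and sends `d a` to the Euler derivative of `a`. -/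
def iota : Forms 𝒜 →ₗ[k] Forms 𝒜 where
  toFun x := G.iotaMat x 0 1
  map_add' x y := by simp
  map_smul' c x := by simp

theorem iotaMat_diag (x : Forms 𝒜) :
    G.iotaMat x 0 0 = eps 𝒜 x ∧ G.iotaMat x 1 0 = 0 ∧ G.iotaMat x 1 1 = x := by
  induction x using Forms.induction with
  | hk c => simp [Matrix.algebraMap_matrix_apply]
  | hf a => simp [iotaMat_fn, eps_fn]
  | hd a => simp [iotaMat_dfn, eps_dfn]
  | hadd x y hx hy => simp [hx, hy]
  | hmul x y hx hy => simp [Matrix.mul_apply, Fin.sum_univ_two, hx, hy]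

theorem iota_fn (a : A) : G.iota (fn 𝒜 a) = 0 := by simp [iota, iotaMat_fn]

theorem iota_dfn (a : A) : G.iota (dfn 𝒜 a) = fn 𝒜 (G.euler a) := by simp [iota, iotaMat_dfn]

theorem iota_algebraMap (c : k) : G.iota (algebraMap k _ c) = 0 := by
  simp [iota, Matrix.algebraMap_matrix_apply]

theorem iota_mul (x y : Forms 𝒜) : G.iota (x * y) = G.iota x * y + eps 𝒜 x * G.iota y := by
  simp [iota, Matrix.mul_apply, Fin.sum_univ_two, iotaMat_diag, add_comm]

theorem _root_.SuperGeom.Forms.eps_eps (x : Forms 𝒜) : eps 𝒜 (eps 𝒜 x) = x := by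
  induction x using Forms.induction with
  | hk c => simp
  | hf a => simp [eps_fn]
  | hd a => simp [eps_dfn]
  | hadd x y hx hy => simp [hx, hy]
  | hmul x y hx hy => simp [hx, hy]

theorem eps_iota (x : Forms 𝒜) : eps 𝒜 (G.iota x) = -G.iota (eps 𝒜 x) := by
  induction x using Forms.induction with
  | hk c => simp [iota_algebraMap]
  | hf a => simp [iota_fn, eps_fn]
  | hd a => simp [iota_dfn, eps_dfn, eps_fn]
  | hadd x y hx hy => simp [hx, hy, add_comm]
  | hmul x y hx hy => simp [iota_mul, hx, hy, add_comm]

/-- The Lie derivative along the Euler vector field, given by Cartan's formula. -/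
def lie : Forms 𝒜 →ₗ[k] Forms 𝒜 := d 𝒜 ∘ₗ G.iota + G.iota ∘ₗ d 𝒜

theorem lie_apply (x : Forms 𝒜) : G.lie x = d 𝒜 (G.iota x) + G.iota (d 𝒜 x) := rfl

theorem lie_fn (a : A) : G.lie (fn 𝒜 a) = fn 𝒜 (G.euler a) := by
  simp [lie_apply, iota_fn, d_fn, iota_dfn]

theorem lie_dfn (a : A) : G.lie (dfn 𝒜 a) = dfn 𝒜 (G.euler a) := by
  simp [lie_apply, iota_dfn, d_fn, d_dfn]

theorem lie_mul (x y : Forms 𝒜) : G.lie (x * y) = G.lie x * y + x * G.lie y := by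
  simp only [lie_apply, d_mul, iota_mul, map_add, eps_d, eps_iota, eps_eps]
  noncomm_ring

/-! ### The weight decomposition of forms -/

/-- The coaction on forms that extends the coaction `φ` on functions and commutes with `d`. -/
def formφ [CharZero k] : Forms 𝒜 →ₐ[k] (Forms 𝒜)[X] :=
  lift 𝒜 (fun a => coeffwise (fn 𝒜) (G.φ a)) (fun a => coeffwise (dfn 𝒜) (G.φ a)) (by
    intro x y h
    induction h with
    | fn_add a b => simp
    | fn_smul c a => simp
    | fn_one =>
      ext w
      simp only [FreeAlgebra.lift_ι_apply, Sum.elim_inl, map_one, coeff_coeffwise, coeff_one]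
      split_ifs <;> simp [fn_one]
    | fn_mul a b =>
      ext w
      simp only [map_mul, FreeAlgebra.lift_ι_apply, Sum.elim_inl, coeff_coeffwise, coeff_mul,
        map_sum, fn_mul]
    | d_add a b => simp
    | d_smul c a => simp
    | d_mul a b =>
      ext w
      simp only [map_mul, map_add, FreeAlgebra.lift_ι_apply, Sum.elim_inl, Sum.elim_inr,
        coeff_coeffwise, coeff_mul, coeff_add, map_sum, dfn_mul, Finset.sum_add_distrib]
    | fn_d i j a b ha hb =>
      ext w
      simp only [map_units_smul, map_mul, FreeAlgebra.lift_ι_apply, Sum.elim_inl, Sum.elim_inr,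
        coeff_units_smul, coeff_mul, coeff_coeffwise]
      exact sum_antidiagonal_swap_smul (fun s t => fn 𝒜 ((G.φ a).coeff s) * dfn 𝒜 ((G.φ b).coeff t))
        (fun s t => dfn 𝒜 ((G.φ b).coeff s) * fn 𝒜 ((G.φ a).coeff t)) _
        (fun s t => fn_dfn (G.coeff_mem ha s) (G.coeff_mem hb t)) w
    | d_d i j a b ha hb =>
      ext w
      simp only [map_units_smul, map_mul, FreeAlgebra.lift_ι_apply, Sum.elim_inr,
        coeff_units_smul, coeff_mul, coeff_coeffwise]
      exact sum_antidiagonal_swap_smul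
        (fun s t => dfn 𝒜 ((G.φ a).coeff s) * dfn 𝒜 ((G.φ b).coeff t))
        (fun s t => dfn 𝒜 ((G.φ b).coeff s) * dfn 𝒜 ((G.φ a).coeff t)) _
        (fun s t => dfn_dfn (G.coeff_mem ha s) (G.coeff_mem hb t)) w
    | d_sq a ha =>
      ext w
      simp only [map_mul, map_zero, FreeAlgebra.lift_ι_apply, Sum.elim_inr, coeff_mul,
        coeff_coeffwise, coeff_zero]
      have h := sum_antidiagonal_swap_smul
        (fun s t => dfn 𝒜 ((G.φ a).coeff s) * dfn 𝒜 ((G.φ a).coeff t))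
        (fun s t => dfn 𝒜 ((G.φ a).coeff s) * dfn 𝒜 ((G.φ a).coeff t)) (-1)
        (fun s t => by simpa using dfn_dfn (G.coeff_mem ha s) (G.coeff_mem ha t)) w
      rw [Units.neg_smul, one_smul, eq_neg_iff_add_eq_zero, ← two_smul k, smul_eq_zero] at h
      exact h.resolve_left two_ne_zero)

section CharZero

variable [CharZero k]

theorem formφ_fn (a : A) : G.formφ (fn 𝒜 a) = coeffwise (fn 𝒜) (G.φ a) := lift_fn ..

theorem formφ_dfn (a : A) : G.formφ (dfn 𝒜 a) = coeffwise (dfn 𝒜) (G.φ a) := lift_dfn ..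

/-- The component of weight `w` of a form. -/
def proj (w : ℕ) : Forms 𝒜 →ₗ[k] Forms 𝒜 where
  toFun x := (G.formφ x).coeff w
  map_add' x y := by simp
  map_smul' c x := by simp

theorem proj_fn (w : ℕ) (a : A) : G.proj w (fn 𝒜 a) = fn 𝒜 ((G.φ a).coeff w) := by
  simp [proj, formφ_fn, coeff_coeffwise]

theorem proj_dfn (w : ℕ) (a : A) : G.proj w (dfn 𝒜 a) = dfn 𝒜 ((G.φ a).coeff w) := by
  simp [proj, formφ_dfn, coeff_coeffwise]

theorem proj_algebraMap (w : ℕ) (c : k) :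
    G.proj w (algebraMap k _ c) = algebraMap k _ (if w = 0 then c else 0) := by
  simp only [proj, LinearMap.coe_mk, AddHom.coe_mk, AlgHom.commutes, Polynomial.algebraMap_apply,
    coeff_C]
  split_ifs <;> simp

theorem proj_mul (w : ℕ) (x y : Forms 𝒜) : G.proj w (x * y) =
    ∑ s ∈ Finset.HasAntidiagonal.antidiagonal w, G.proj s.1 x * G.proj s.2 y := by
  simp [proj, coeff_mul]

theorem proj_eps (w : ℕ) (x : Forms 𝒜) : G.proj w (eps 𝒜 x) = eps 𝒜 (G.proj w x) := by
  induction x using Forms.induction generalizing w with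
  | hk c => simp [proj_algebraMap]
  | hf a => simp [proj_fn, eps_fn]
  | hd a => simp [proj_dfn, eps_dfn]
  | hadd x y hx hy => simp [hx, hy]
  | hmul x y hx hy => simp [proj_mul, hx, hy]

/-- A skew derivation that preserves weights on functions and their differentials preserves the
weights of all forms. -/
theorem proj_comm (D : Forms 𝒜 →ₗ[k] Forms 𝒜) (hk : ∀ c, D (algebraMap k _ c) = 0)
    (hmul : ∀ x y, D (x * y) = D x * y + eps 𝒜 x * D y)
    (hf : ∀ w a, G.proj w (D (fn 𝒜 a)) = D (G.proj w (fn 𝒜 a)))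
    (hd : ∀ w a, G.proj w (D (dfn 𝒜 a)) = D (G.proj w (dfn 𝒜 a)))
    (w : ℕ) (x : Forms 𝒜) : G.proj w (D x) = D (G.proj w x) := by
  induction x using Forms.induction generalizing w with
  | hk c => simp [hk, proj_algebraMap]
  | hf a => exact hf w a
  | hd a => exact hd w a
  | hadd x y hx hy => simp [hx, hy]
  | hmul x y hx hy => simp [proj_mul, hmul, hx, hy, proj_eps, Finset.sum_add_distrib]

theorem proj_d (w : ℕ) (x : Forms 𝒜) : G.proj w (d 𝒜 x) = d 𝒜 (G.proj w x) :=
  G.proj_comm (d 𝒜) (d_algebraMap 𝒜) (d_mul 𝒜) (fun w a => by simp [proj_fn, proj_dfn, d_fn])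
    (fun w a => by simp [proj_dfn, d_dfn]) w x

theorem proj_iota (w : ℕ) (x : Forms 𝒜) : G.proj w (G.iota x) = G.iota (G.proj w x) :=
  G.proj_comm G.iota G.iota_algebraMap G.iota_mul (fun w a => by simp [proj_fn, iota_fn])
    (fun w a => by simp [proj_dfn, iota_dfn, proj_fn, coeff_euler, euler_coeff]) w x

/-- The Lie derivative along the Euler vector field is multiplication by the weight. -/
theorem lie_proj (w : ℕ) (x : Forms 𝒜) : G.lie (G.proj w x) = w • G.proj w x := by
  induction x using Forms.induction generalizing w with
  | hk c =>
    rw [proj_algebraMap]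
    split_ifs <;> simp_all [lie_apply, iota_algebraMap, d_algebraMap]
  | hf a => rw [proj_fn, lie_fn, euler_coeff, map_nsmul]
  | hd a => rw [proj_dfn, lie_dfn, euler_coeff, map_nsmul]
  | hadd x y hx hy => simp [hx, hy]
  | hmul x y hx hy =>
    rw [proj_mul, map_sum, Finset.smul_sum]
    refine Finset.sum_congr rfl fun s hs => ?_
    rw [lie_mul, hx, hy, ← Finset.HasAntidiagonal.mem_antidiagonal.mp hs, add_smul,
      smul_mul_assoc, mul_smul_comm]

theorem formφ_eval_one (x : Forms 𝒜) : (G.formφ x).eval 1 = x := by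
  have h : ∀ (f : A →ₗ[k] Forms 𝒜) (p : A[X]), (coeffwise f p).eval 1 = f (p.eval 1) := by
    intro f p
    rw [eval_eq_sum_range' (n := max (p.natDegree) (coeffwise f p).natDegree + 1) (by simp),
      eval_eq_sum_range' (n := max (p.natDegree) (coeffwise f p).natDegree + 1) (by simp)]
    simp [coeff_coeffwise]
  induction x using Forms.induction with
  | hk c => simp [Polynomial.algebraMap_apply]
  | hf a => rw [formφ_fn, h, G.eval_one]
  | hd a => rw [formφ_dfn, h, G.eval_one]
  | hadd x y hx hy => simp [hx, hy]
  | hmul x y hx hy => rw [map_mul, eval_one_mul, hx, hy]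

/-! ### The local homotopy -/

/-- The inverse of the Lie derivative on forms of positive weight: division by `w` in weight
`w > 0`, and zero in weight `0` since `0⁻¹ = 0`. -/
def lieInv : Forms 𝒜 →ₗ[k] Forms 𝒜 :=
  Polynomial.lsum (fun w : ℕ => ((w : k)⁻¹ • (LinearMap.id : Forms 𝒜 →ₗ[k] Forms 𝒜))) ∘ₗ
    G.formφ.toLinearMap

theorem lieInv_apply (x : Forms 𝒜) :
    G.lieInv x = ∑ w ∈ (G.formφ x).support, (w : k)⁻¹ • G.proj w x := rfl

theorem lieInv_eq_sum (x : Forms 𝒜) {N : ℕ} (hN : (G.formφ x).natDegree < N) :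
    G.lieInv x = ∑ w ∈ Finset.range N, (w : k)⁻¹ • G.proj w x := by
  rw [lieInv_apply]
  refine Finset.sum_subset (fun w hw => ?_) fun w _ hw => ?_
  · exact Finset.mem_range.mpr ((le_natDegree_of_mem_supp _ hw).trans_lt hN)
  · rw [show G.proj w x = 0 from notMem_support_iff.mp hw, smul_zero]

theorem lieInv_comm (D : Forms 𝒜 →ₗ[k] Forms 𝒜) (hD : ∀ w x, G.proj w (D x) = D (G.proj w x))
    (x : Forms 𝒜) : G.lieInv (D x) = D (G.lieInv x) := by
  rw [G.lieInv_eq_sum x (N := max (G.formφ x).natDegree (G.formφ (D x)).natDegree + 1) (by simp),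
    G.lieInv_eq_sum (D x) (N := max (G.formφ x).natDegree (G.formφ (D x)).natDegree + 1) (by simp)]
  simp [hD]

theorem lie_lieInv (x : Forms 𝒜) : G.lie (G.lieInv x) = x - G.proj 0 x := by
  have h : x = ∑ w ∈ Finset.range ((G.formφ x).natDegree + 1), G.proj w x := by
    conv_lhs => rw [← G.formφ_eval_one x, eval_eq_sum_range]
    simp [proj]
  rw [G.lieInv_eq_sum x (Nat.lt_succ_self _), map_sum, Finset.sum_range_succ', eq_sub_iff_add_eq]
  conv_rhs => rw [h, Finset.sum_range_succ']
  congr 1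
  · simp only [CharP.cast_eq_zero, inv_zero, zero_smul, map_zero, add_zero]
    refine Finset.sum_congr rfl fun w _ => ?_
    rw [map_smul, lie_proj, ← Nat.cast_smul_eq_nsmul k, smul_smul, inv_mul_cancel₀, one_smul]
    exact_mod_cast Nat.succ_ne_zero w

/-- The local homotopy `ι L⁻¹`, where `L` is the Lie derivative along the Euler vector field. It is
a homotopy between the identity and the projection to weight zero. -/
def homotopy : Forms 𝒜 →ₗ[k] Forms 𝒜 := G.iota ∘ₗ G.lieInv

theorem homotopy_apply (x : Forms 𝒜) : G.homotopy x = G.iota (G.lieInv x) := rfl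

/-- The inverse Lie derivative may also be applied last, since `ι` preserves weights. -/
theorem homotopy_eq_lieInv_iota (x : Forms 𝒜) : G.homotopy x = G.lieInv (G.iota x) :=
  (G.lieInv_comm _ G.proj_iota x).symm

theorem d_homotopy (x : Forms 𝒜) :
    d 𝒜 (G.homotopy x) + G.homotopy (d 𝒜 x) = x - G.proj 0 x := by
  rw [← G.lie_lieInv, lie_apply, homotopy_apply, homotopy_apply, G.lieInv_comm _ G.proj_d]

end CharZero

end WeightGrading

/-! ### Degree, parity and the filtration -/

namespace Forms

variable {k A : Type u} [Field k] [Ring A] [Algebra k A] {𝒜 : ZMod 2 → Submodule k A}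

theorem fn_mem_piece {p : ZMod 2} {a : A} (ha : a ∈ 𝒜 p) : fn 𝒜 a ∈ piece 𝒜 0 p :=
  Submodule.subset_span ⟨fun _ => a, fun _ => p, fun _ => ha, by simp, by simp⟩

theorem mul_dfn_mem_piece {n : ℕ} {p q : ZMod 2} {x : Forms 𝒜} {b : A} (hx : x ∈ piece 𝒜 n p)
    (hb : b ∈ 𝒜 q) : x * dfn 𝒜 b ∈ piece 𝒜 (n + 1) (p + q) := by
  induction hx using Submodule.span_induction with
  | zero => simp
  | add x y _ _ hx hy => rw [add_mul]; exact add_mem hx hy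
  | smul c x _ hx => rw [smul_mul_assoc]; exact Submodule.smul_mem _ c hx
  | mem w hw =>
    obtain ⟨a, r, ha, hr, rfl⟩ := hw
    refine Submodule.subset_span ⟨Fin.snoc (α := fun _ => A) a b,
      Fin.snoc (α := fun _ => ZMod 2) r q, ?_, ?_, ?_⟩
    · intro i
      refine Fin.lastCases ?_ (fun i => ?_) i <;> simp [hb, ha]
    · rw [Fin.sum_univ_castSucc]; simp [hr]
    · have h0 : (Fin.snoc (α := fun _ => A) a b : Fin (n + 1 + 1) → A) 0 = a 0 := by
        rw [← Fin.castSucc_zero, Fin.snoc_castSucc]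
      rw [List.ofFn_succ', h0]
      simp only [Fin.succ_castSucc, Fin.snoc_castSucc, Fin.succ_last, Fin.snoc_last,
        List.concat_eq_append, List.prod_append, List.prod_singleton, mul_assoc]

/-- The forms of degree `n` and parity `p` are built up from functions by multiplying on the right
by differentials of homogeneous functions. -/
theorem piece_le (T : ℕ → ZMod 2 → Submodule k (Forms 𝒜))
    (hfn : ∀ p, ∀ a ∈ 𝒜 p, fn 𝒜 a ∈ T 0 p)
    (hmul : ∀ n p q, ∀ x ∈ piece 𝒜 n p, x ∈ T n p → ∀ a ∈ 𝒜 q, x * dfn 𝒜 a ∈ T (n + 1) (p + q))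
    (n : ℕ) (p : ZMod 2) : piece 𝒜 n p ≤ T n p := by
  induction n generalizing p with
  | zero =>
    refine Submodule.span_le.mpr ?_
    rintro _ ⟨a, q, ha, rfl, rfl⟩
    simpa using hfn _ _ (ha 0)
  | succ n ih =>
    refine Submodule.span_le.mpr ?_
    rintro _ ⟨a, q, ha, rfl, rfl⟩
    rw [Fin.sum_univ_castSucc, List.ofFn_succ', List.concat_eq_append, List.prod_append,
      List.prod_singleton, ← mul_assoc]
    have h : fn 𝒜 (a 0) * (List.ofFn fun i : Fin n => dfn 𝒜 (a i.castSucc.succ)).prod ∈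
        piece 𝒜 n (∑ i : Fin (n + 1), q i.castSucc) :=
      Submodule.subset_span ⟨fun i => a i.castSucc, fun i => q i.castSucc, fun i => ha _, rfl, rfl⟩
    exact hmul _ _ _ _ h (ih _ h) _ (ha _)

theorem mul_fn_mem_piece (hA : IsSuperalgebra 𝒜) {n : ℕ} {p q : ZMod 2} {x : Forms 𝒜} {b : A}
    (hx : x ∈ piece 𝒜 n p) (hb : b ∈ 𝒜 q) : x * fn 𝒜 b ∈ piece 𝒜 n (p + q) := by
  refine piece_le (fun n p => (piece 𝒜 n (p + q)).comap (LinearMap.mulRight k (fn 𝒜 b)))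
    (fun p a ha => ?_) (fun n p r x _ hx a ha => ?_) n p hx
  · simpa [← fn_mul] using fn_mem_piece (hA.mul_mem _ _ _ _ ha hb)
  · simp only [Submodule.mem_comap, LinearMap.mulRight_apply] at hx ⊢
    have h : x * dfn 𝒜 a * fn 𝒜 b = ((-1 : ℤˣ) ^ (q * r)) • (x * fn 𝒜 b * dfn 𝒜 a) := by
      rw [mul_assoc x (fn 𝒜 b), fn_dfn hb ha, mul_smul_comm, smul_smul]
      simp [mul_assoc]
    rw [h, add_right_comm]
    exact units_smul_mem _ _ (mul_dfn_mem_piece hx ha)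

theorem eps_mem_piece {n : ℕ} {p : ZMod 2} {x : Forms 𝒜} (hx : x ∈ piece 𝒜 n p) :
    eps 𝒜 x ∈ piece 𝒜 n p := by
  refine piece_le (fun n p => (piece 𝒜 n p).comap (eps 𝒜).toLinearMap)
    (fun p a ha => ?_) (fun n p r x _ hx a ha => ?_) n p hx
  · simpa [eps_fn] using fn_mem_piece ha
  · simpa [eps_dfn] using mul_dfn_mem_piece hx ha

theorem mem_oddIdeal {a : A} (ha : a ∈ 𝒜 1) : a ∈ oddIdeal 𝒜 := by
  have h : 1 * a * 1 ∈ oddIdeal 𝒜 :=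
    Submodule.mul_mem_mul (Submodule.mul_mem_mul trivial ha) trivial
  rwa [one_mul, mul_one] at h

theorem oddIdeal_mul_top : oddIdeal 𝒜 * ⊤ ≤ oddIdeal 𝒜 := by
  rw [oddIdeal, mul_assoc]
  exact mul_le_mul' le_rfl le_top

theorem top_mul_oddIdeal : ⊤ * oddIdeal 𝒜 ≤ oddIdeal 𝒜 := by
  rw [oddIdeal, ← mul_assoc, ← mul_assoc]
  exact mul_le_mul' (mul_le_mul' le_top le_rfl) le_rfl

theorem oddIdeal_sq_le : oddIdeal 𝒜 * oddIdeal 𝒜 ≤ oddIdeal 𝒜 :=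
  (mul_le_mul' le_rfl le_top).trans oddIdeal_mul_top

/-- A property of subspaces that is stable under products holds for the steps of the filtration
if it holds for `⊤`, for the scalars and for the subspace `N + dN`. -/
theorem filt_induction (hA : IsSuperalgebra 𝒜) (P : Submodule k (Forms 𝒜) → Prop) (htop : P ⊤)
    (hone : P 1) (hmul : ∀ S T, P S → P T → P (S * T))
    (hodd : P ((oddIdeal 𝒜).map (fn 𝒜) ⊔ (oddIdeal 𝒜).map (dfn 𝒜))) (i : ℕ) :
    P (filt 𝒜 i) := by
  rw [filt_eq hA]
  refine hmul _ _ (hmul _ _ htop ?_) htop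
  induction i with
  | zero => rwa [pow_zero]
  | succ i ih => rw [pow_succ]; exact hmul _ _ ih hodd

theorem mul_mem_mul_top {S : Submodule k (Forms 𝒜)} {x : Forms 𝒜} (hx : x ∈ S * ⊤)
    (y : Forms 𝒜) : x * y ∈ S * ⊤ := by
  induction hx using Submodule.mul_induction_on' with
  | mem_mul_mem a ha b _ => rw [mul_assoc]; exact Submodule.mul_mem_mul ha trivial
  | add a _ b _ ha hb => rw [add_mul]; exact add_mem ha hb

theorem left_mul_mem_mul_top {S : Submodule k (Forms 𝒜)} (hS : ⊤ * S ≤ S * ⊤) {x : Forms 𝒜}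
    (hx : x ∈ S * ⊤) (y : Forms 𝒜) : y * x ∈ S * ⊤ := by
  induction hx using Submodule.mul_induction_on' with
  | mem_mul_mem a ha b _ =>
    rw [← mul_assoc]
    exact mul_mem_mul_top (hS (Submodule.mul_mem_mul trivial ha)) b
  | add a _ b _ ha hb => rw [mul_add]; exact add_mem ha hb

theorem mem_mul_top {S : Submodule k (Forms 𝒜)} {x : Forms 𝒜} (hx : x ∈ S) : x ∈ S * ⊤ := by
  rw [← mul_one x]
  exact Submodule.mul_mem_mul hx trivial

/-- The right ideal of forms generated by `N` is two-sided, since `N` is generated by homogeneous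
elements. -/
theorem fn_oddIdeal_comm (hA : IsSuperalgebra 𝒜) :
    ⊤ * (oddIdeal 𝒜).map (fn 𝒜) ≤ (oddIdeal 𝒜).map (fn 𝒜) * ⊤ := by
  have key : ∀ x : Forms 𝒜, ∀ y ∈ (oddIdeal 𝒜).map (fn 𝒜),
      x * y ∈ (oddIdeal 𝒜).map (fn 𝒜) * ⊤ := by
    intro x
    induction x using Forms.induction with
    | hk c =>
      intro y hy
      rw [← Algebra.smul_def]
      exact Submodule.smul_mem _ _ (mem_mul_top hy)
    | hf a =>
      rintro _ ⟨m, hm, rfl⟩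
      rw [← fn_mul]
      exact mem_mul_top ⟨_, top_mul_oddIdeal (Submodule.mul_mem_mul trivial hm), rfl⟩
    | hd a =>
      intro y hy
      rw [oddIdeal_homogeneous hA, Submodule.map_span] at hy
      induction hy using Submodule.span_induction with
      | zero => simp
      | add x y _ _ hx hy => rw [mul_add]; exact add_mem hx hy
      | smul c x _ hx => rw [mul_smul_comm]; exact Submodule.smul_mem _ c hx
      | mem y hy =>
        obtain ⟨m, ⟨hm, i, hi⟩, rfl⟩ := hy
        have ha := hA.mem_span a
        induction ha using Submodule.span_induction with
        | zero => simp
        | add x y _ _ hx hy => rw [map_add, add_mul]; exact add_mem hx hy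
        | smul c x _ hx => rw [map_smul, smul_mul_assoc]; exact Submodule.smul_mem _ c hx
        | mem a ha =>
          obtain ⟨j, hj⟩ := ha
          have h : dfn 𝒜 a * fn 𝒜 m = ((-1 : ℤˣ) ^ (i * j)) • (fn 𝒜 m * dfn 𝒜 a) := by
            rw [fn_dfn hi hj, smul_smul]; simp
          rw [h]
          exact units_smul_mem _ _ (Submodule.mul_mem_mul ⟨m, hm, rfl⟩ trivial)
    | hadd x z hx hz => intro y hy; rw [add_mul]; exact add_mem (hx y hy) (hz y hy)
    | hmul x z hx hz =>
      intro y hy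
      rw [mul_assoc]
      have h := hz y hy
      generalize z * y = t at h
      induction h using Submodule.mul_induction_on' with
      | mem_mul_mem y hy t _ => rw [← mul_assoc]; exact mul_mem_mul_top (hx y hy) t
      | add a _ b _ ha hb => rw [mul_add]; exact add_mem ha hb
  exact Submodule.mul_le.mpr fun x _ y hy => key x y hy

theorem fn_oddIdeal_sq_comm (hA : IsSuperalgebra 𝒜) :
    ⊤ * ((oddIdeal 𝒜).map (fn 𝒜) * (oddIdeal 𝒜).map (fn 𝒜)) ≤
      (oddIdeal 𝒜).map (fn 𝒜) * (oddIdeal 𝒜).map (fn 𝒜) * ⊤ := by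
  have hc := fn_oddIdeal_comm hA
  rw [← mul_assoc]
  refine (mul_le_mul' hc le_rfl).trans ?_
  rw [mul_assoc, mul_assoc]
  exact mul_le_mul' le_rfl hc

end Forms

namespace WeightGrading

open Forms

variable {k A : Type u} [Field k] [Ring A] [Algebra k A]
  {𝒜 : ZMod 2 → Submodule k A} (G : WeightGrading 𝒜)

theorem coeff_succ_mem (w : ℕ) (a : A) : (G.φ a).coeff (w + 1) ∈ oddIdeal 𝒜 := by
  have ha := G.isSuperalgebra.mem_span a
  induction ha using Submodule.span_induction with
  | zero => simp
  | add x y _ _ hx hy => simpa using add_mem hx hy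
  | smul c x _ hx => simpa using Submodule.smul_mem _ c hx
  | mem a ha =>
    obtain ⟨i, hi⟩ := ha
    fin_cases i
    · exact oddIdeal_sq_le (G.coeff_even a hi w)
    · exact mem_oddIdeal (G.coeff_mem hi _)

theorem euler_mem_oddIdeal (a : A) : G.euler a ∈ oddIdeal 𝒜 := by
  rw [euler_eq_sum]
  exact sum_mem fun w _ => nsmul_mem (G.coeff_succ_mem w a) _

theorem coeff_zero_oddIdeal {a : A} (ha : a ∈ oddIdeal 𝒜) : (G.φ a).coeff 0 = 0 := by
  induction ha using Submodule.mul_induction_on' with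
  | mem_mul_mem x hx c _ =>
    induction hx using Submodule.mul_induction_on' with
    | mem_mul_mem a _ b hb => simp [mul_coeff_zero, G.φ_odd b hb]
    | add x _ y _ hx hy => rw [add_mul, map_add, coeff_add, hx, hy, add_zero]
  | add x _ y _ hx hy => rw [map_add, coeff_add, hx, hy, add_zero]

theorem coeff_mem_oddIdeal {a : A} (ha : a ∈ oddIdeal 𝒜) (w : ℕ) :
    (G.φ a).coeff w ∈ oddIdeal 𝒜 := by
  cases w with
  | zero => rw [G.coeff_zero_oddIdeal ha]; exact zero_mem _
  | succ w => exact G.coeff_succ_mem w a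

theorem iota_mem_piece {n : ℕ} {p : ZMod 2} {x : Forms 𝒜} (hx : x ∈ piece 𝒜 (n + 1) p) :
    G.iota x ∈ piece 𝒜 n p := by
  refine piece_le (fun n p => (if n = 0 then ⊥ else piece 𝒜 (n - 1) p).comap G.iota)
    (fun p a ha => ?_) (fun n p q x hx hx' a ha => ?_) (n + 1) p hx
  · simp [iota_fn]
  · simp only [Submodule.mem_comap, iota_mul, iota_dfn, Nat.add_eq_zero_iff, one_ne_zero,
      and_false, if_false, Nat.add_sub_cancel] at hx' ⊢
    refine add_mem ?_ (mul_fn_mem_piece G.isSuperalgebra (eps_mem_piece hx) (G.euler_mem ha))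
    rcases n with _ | n
    · have h0 : G.iota x = 0 := by simpa using hx'
      simp [h0]
    · exact mul_dfn_mem_piece (by simpa using hx') ha

theorem iota_piece_zero {p : ZMod 2} {x : Forms 𝒜} (hx : x ∈ piece 𝒜 0 p) : G.iota x = 0 := by
  have h := piece_le (fun n _ => if n = 0 then LinearMap.ker G.iota else ⊤)
    (fun p a ha => by simp [iota_fn]) (fun n p q x hx hx' a ha => by simp) 0 p hx
  simpa using h

theorem iota_mem_filt (i : ℕ) {x : Forms 𝒜} (hx : x ∈ filt 𝒜 i) : G.iota x ∈ filt 𝒜 i := by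
  refine (filt_induction G.isSuperalgebra
    (fun S => ∀ x ∈ S, G.iota x ∈ S ∧ eps 𝒜 x ∈ S) (fun _ _ => ⟨trivial, trivial⟩)
    ?_ ?_ ?_ i x hx).1
  · intro x hx
    obtain ⟨c, rfl⟩ := Submodule.mem_one.mp hx
    exact ⟨by simp [iota_algebraMap], by simp⟩
  · intro S T hS hT x hx
    induction hx using Submodule.mul_induction_on' with
    | mem_mul_mem a ha b hb =>
      rw [iota_mul, map_mul]
      exact ⟨add_mem (Submodule.mul_mem_mul (hS a ha).1 hb)
        (Submodule.mul_mem_mul (hS a ha).2 (hT b hb).1),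
        Submodule.mul_mem_mul (hS a ha).2 (hT b hb).2⟩
    | add x _ y _ hx hy =>
      rw [map_add, map_add]
      exact ⟨add_mem hx.1 hy.1, add_mem hx.2 hy.2⟩
  · intro x hx
    obtain ⟨_, ⟨a, ha, rfl⟩, _, ⟨b, hb, rfl⟩, rfl⟩ := Submodule.mem_sup.mp hx
    simp only [map_add, iota_fn, iota_dfn, eps_fn, eps_dfn, zero_add]
    exact ⟨Submodule.mem_sup_left ⟨_, G.euler_mem_oddIdeal b, rfl⟩,
      add_mem (Submodule.mem_sup_left ⟨a, ha, rfl⟩)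
        (neg_mem (Submodule.mem_sup_right ⟨b, hb, rfl⟩))⟩

section CharZero

variable [CharZero k]

theorem proj_mem_piece (w : ℕ) {n : ℕ} {p : ZMod 2} {x : Forms 𝒜} (hx : x ∈ piece 𝒜 n p) :
    G.proj w x ∈ piece 𝒜 n p := by
  have h := piece_le (fun n p => ⨅ w, (piece 𝒜 n p).comap (G.proj w))
    (fun p a ha => ?_) (fun n p q x _ hx a ha => ?_) n p hx
  · exact (Submodule.mem_iInf _).mp h w
  · simp only [Submodule.mem_iInf, Submodule.mem_comap, proj_fn]
    exact fun w => fn_mem_piece (G.coeff_mem ha w)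
  · simp only [Submodule.mem_iInf, Submodule.mem_comap, proj_mul, proj_dfn] at hx ⊢
    exact fun w => sum_mem fun s _ => mul_dfn_mem_piece (hx _) (G.coeff_mem ha _)

theorem proj_mem_filt (w i : ℕ) {x : Forms 𝒜} (hx : x ∈ filt 𝒜 i) : G.proj w x ∈ filt 𝒜 i := by
  refine filt_induction G.isSuperalgebra
    (fun S => ∀ x ∈ S, ∀ w, G.proj w x ∈ S) (fun _ _ _ => trivial) ?_ ?_ ?_ i x hx w
  · intro x hx w
    obtain ⟨c, rfl⟩ := Submodule.mem_one.mp hx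
    rw [proj_algebraMap]
    exact Submodule.mem_one.mpr ⟨_, rfl⟩
  · intro S T hS hT x hx
    induction hx using Submodule.mul_induction_on' with
    | mem_mul_mem a ha b hb =>
      intro w
      rw [proj_mul]
      exact sum_mem fun s _ => Submodule.mul_mem_mul (hS a ha _) (hT b hb _)
    | add x _ y _ hx hy => exact fun w => by rw [map_add]; exact add_mem (hx w) (hy w)
  · intro x hx w
    obtain ⟨_, ⟨a, ha, rfl⟩, _, ⟨b, hb, rfl⟩, rfl⟩ := Submodule.mem_sup.mp hx
    rw [map_add, proj_fn, proj_dfn]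
    exact add_mem (Submodule.mem_sup_left ⟨_, G.coeff_mem_oddIdeal ha w, rfl⟩)
      (Submodule.mem_sup_right ⟨_, G.coeff_mem_oddIdeal hb w, rfl⟩)

theorem homotopy_mem {i n : ℕ} {p : ZMod 2} {x : Forms 𝒜} (hx : x ∈ filtPiece 𝒜 i (n + 1) p) :
    G.homotopy x ∈ filtPiece 𝒜 i n p := by
  have h : G.lieInv x ∈ filtPiece 𝒜 i (n + 1) p := by
    rw [lieInv_apply]
    exact sum_mem fun w _ => Submodule.smul_mem _ _
      ⟨G.proj_mem_filt w i hx.1, G.proj_mem_piece w hx.2⟩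
  exact ⟨G.iota_mem_filt i h.1, G.iota_mem_piece h.2⟩

theorem homotopy_piece_zero {p : ZMod 2} {x : Forms 𝒜} (hx : x ∈ piece 𝒜 0 p) :
    G.homotopy x = 0 := by
  rw [homotopy_eq_lieInv_iota, G.iota_piece_zero hx, map_zero]

theorem proj_zero_piece_one {n : ℕ} {x : Forms 𝒜} (hx : x ∈ piece 𝒜 n 1) : G.proj 0 x = 0 := by
  have h := piece_le (fun n p => ⨅ _ : p = 1, LinearMap.ker (G.proj 0))
    (fun p a ha => ?_) (fun n p q x _ hx a ha => ?_) n 1 hx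
  · simpa using h
  · simp only [Submodule.mem_iInf, LinearMap.mem_ker, proj_fn]
    rintro rfl
    rw [G.coeff_zero_oddIdeal (mem_oddIdeal ha), map_zero]
  · simp only [Submodule.mem_iInf, LinearMap.mem_ker, proj_mul, proj_dfn] at hx ⊢
    intro hpq
    have h01 : ∀ p q : ZMod 2, p + q = 1 → p = 1 ∨ q = 1 := by decide
    have := h01 p q hpq
    rcases this with rfl | rfl
    · simp [hx rfl]
    · simp [G.coeff_zero_oddIdeal (mem_oddIdeal ha)]

theorem proj_zero_filt {i : ℕ} {x : Forms 𝒜} (hx : x ∈ filt 𝒜 (i + 1)) : G.proj 0 x = 0 := by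
  have hl : ∀ S T : Submodule k (Forms 𝒜), (∀ x ∈ S, G.proj 0 x = 0) →
      ∀ x ∈ S * T, G.proj 0 x = 0 := by
    intro S T hS x hx
    induction hx using Submodule.mul_induction_on' with
    | mem_mul_mem a ha b hb => simp [proj_mul, hS a ha]
    | add x _ y _ hx hy => rw [map_add, hx, hy, add_zero]
  have hr : ∀ S T : Submodule k (Forms 𝒜), (∀ x ∈ T, G.proj 0 x = 0) →
      ∀ x ∈ S * T, G.proj 0 x = 0 := by
    intro S T hT x hx
    induction hx using Submodule.mul_induction_on' with
    | mem_mul_mem a ha b hb => simp [proj_mul, hT b hb]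
    | add x _ y _ hx hy => rw [map_add, hx, hy, add_zero]
  rw [filt_eq G.isSuperalgebra, pow_succ] at hx
  refine hl _ _ (hr _ _ (hr _ _ fun x hx => ?_)) x hx
  obtain ⟨_, ⟨a, ha, rfl⟩, _, ⟨b, hb, rfl⟩, rfl⟩ := Submodule.mem_sup.mp hx
  rw [map_add, proj_fn, proj_dfn, G.coeff_zero_oddIdeal ha, G.coeff_zero_oddIdeal hb]
  simp

end CharZero

/-! ### Independence of the weight grading -/

theorem iota_mem_oddIdeal (x : Forms 𝒜) : G.iota x ∈ (oddIdeal 𝒜).map (fn 𝒜) * ⊤ := by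
  induction x using Forms.induction with
  | hk c => simp [iota_algebraMap]
  | hf a => simp [iota_fn]
  | hd a =>
    rw [iota_dfn]
    exact mem_mul_top ⟨_, G.euler_mem_oddIdeal a, rfl⟩
  | hadd x y hx hy => rw [map_add]; exact add_mem hx hy
  | hmul x y hx hy =>
    rw [iota_mul]
    exact add_mem (mul_mem_mul_top hx y)
      (left_mul_mem_mul_top (fn_oddIdeal_comm G.isSuperalgebra) hy _)

theorem iota_iota (x : Forms 𝒜) : G.iota (G.iota x) = 0 := by
  induction x using Forms.induction with
  | hk c => simp [iota_algebraMap]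
  | hf a => simp [iota_fn]
  | hd a => simp [iota_dfn, iota_fn]
  | hadd x y hx hy => simp [hx, hy]
  | hmul x y hx hy => simp [iota_mul, hx, hy, eps_iota]

variable {B : Type u} [Ring B] [Algebra k B] {ℬ : ZMod 2 → Submodule k B} (H : WeightGrading ℬ)
  (f : A →ₐ[k] B)

theorem _root_.SuperGeom.Forms.map_mem_oddIdeal (hf : ∀ i, ∀ a ∈ 𝒜 i, f a ∈ ℬ i)
    {a : A} (ha : a ∈ oddIdeal 𝒜) :
    f a ∈ oddIdeal ℬ := by
  have hN : (oddIdeal 𝒜).map f.toLinearMap ≤ oddIdeal ℬ := by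
    rw [oddIdeal, oddIdeal, Submodule.map_mul, Submodule.map_mul]
    refine mul_le_mul' (mul_le_mul' le_top ?_) le_top
    rintro _ ⟨a, ha, rfl⟩
    exact hf 1 a ha
  exact hN ⟨a, ha, rfl⟩

/-- Euler vector fields are compatible with homomorphisms of superalgebras up to `N ^ 2`: on odd
functions they are the identity, and they map even functions to `N ^ 2`. -/
theorem euler_map_sub_mem (hf : ∀ i, ∀ a ∈ 𝒜 i, f a ∈ ℬ i) (a : A) :
    H.euler (f a) - f (G.euler a) ∈ oddIdeal ℬ * oddIdeal ℬ := by
  have hN : (oddIdeal 𝒜).map f.toLinearMap ≤ oddIdeal ℬ := by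
    rintro _ ⟨a, ha, rfl⟩
    exact map_mem_oddIdeal f hf ha
  have ha := G.isSuperalgebra.mem_span a
  induction ha using Submodule.span_induction with
  | zero => simp
  | add x y _ _ hx hy => simpa [add_sub_add_comm] using add_mem hx hy
  | smul c x _ hx => simpa [smul_sub] using Submodule.smul_mem _ c hx
  | mem a ha =>
    obtain ⟨i, hi⟩ := ha
    fin_cases i
    · refine sub_mem (H.euler_even (hf 0 a hi)) ?_
      have h := Submodule.mem_map_of_mem (f := f.toLinearMap) (G.euler_even hi)
      rw [Submodule.map_mul] at h
      exact mul_le_mul' hN hN h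
    · rw [G.euler_odd hi, H.euler_odd (hf 1 a hi), sub_self]
      exact zero_mem _

theorem iota_map_sub_mem (hf : ∀ i, ∀ a ∈ 𝒜 i, f a ∈ ℬ i) (x : Forms 𝒜) :
    H.iota (map f hf x) - map f hf (G.iota x) ∈
      (oddIdeal ℬ).map (fn ℬ) * (oddIdeal ℬ).map (fn ℬ) * ⊤ := by
  induction x using Forms.induction with
  | hk c => simp [iota_algebraMap]
  | hf a => simp [iota_fn, map_fn]
  | hd a =>
    rw [map_dfn, iota_dfn, iota_dfn, map_fn, ← map_sub]
    have h : ∀ b ∈ oddIdeal ℬ * oddIdeal ℬ,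
        fn ℬ b ∈ (oddIdeal ℬ).map (fn ℬ) * (oddIdeal ℬ).map (fn ℬ) := fun b hb => by
      induction hb using Submodule.mul_induction_on' with
      | mem_mul_mem a ha b hb =>
        rw [fn_mul]
        exact Submodule.mul_mem_mul ⟨a, ha, rfl⟩ ⟨b, hb, rfl⟩
      | add x _ y _ hx hy => rw [map_add]; exact add_mem hx hy
    exact mem_mul_top (h _ (G.euler_map_sub_mem H f hf a))
  | hadd x y hx hy =>
    simp only [map_add, add_sub_add_comm]
    exact add_mem hx hy
  | hmul x y hx hy =>
    have e : H.iota (map f hf (x * y)) - map f hf (G.iota (x * y)) =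
        (H.iota (map f hf x) - map f hf (G.iota x)) * map f hf y +
          eps ℬ (map f hf x) * (H.iota (map f hf y) - map f hf (G.iota y)) := by
      simp only [map_mul, iota_mul, map_add, map_eps]
      noncomm_ring
    rw [e]
    exact add_mem (mul_mem_mul_top hx _)
      (left_mul_mem_mul_top (fn_oddIdeal_sq_comm H.isSuperalgebra) hy _)

/-- The contractions with two Euler vector fields compose to zero along a homomorphism of
superalgebras if `N ^ 3` vanishes in its target. -/
theorem iota_map_iota (hf : ∀ i, ∀ a ∈ 𝒜 i, f a ∈ ℬ i)
    (hB : oddIdeal ℬ * oddIdeal ℬ * oddIdeal ℬ = ⊥) (x : Forms 𝒜) :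
    H.iota (map f hf (G.iota x)) = 0 := by
  -- `N` annihilates `N ^ 2 Ω`.
  have hI : ∀ a ∈ oddIdeal ℬ, ∀ y ∈ (oddIdeal ℬ).map (fn ℬ) * (oddIdeal ℬ).map (fn ℬ) * ⊤,
      fn ℬ a * y = 0 := by
    intro a ha y hy
    induction hy using Submodule.mul_induction_on' with
    | mem_mul_mem y hy z _ =>
      induction hy using Submodule.mul_induction_on' with
      | mem_mul_mem b hb c hc =>
        obtain ⟨b, hb, rfl⟩ := hb
        obtain ⟨c, hc, rfl⟩ := hc
        have h : a * b * c ∈ oddIdeal ℬ * oddIdeal ℬ * oddIdeal ℬ :=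
          Submodule.mul_mem_mul (Submodule.mul_mem_mul ha hb) hc
        rw [hB, Submodule.mem_bot] at h
        rw [← mul_assoc, ← mul_assoc, ← fn_mul, ← fn_mul, h, map_zero, zero_mul]
      | add x _ y _ hx hy => rw [add_mul, mul_add, hx, hy, add_zero]
    | add x _ y _ hx hy => rw [mul_add, hx, hy, add_zero]
  -- The difference of the contractions is linear over functions and takes values in `N ^ 2 Ω`, so
  -- it vanishes on `N Ω`, which contains all values of the first contraction.
  have hN : ∀ y ∈ (oddIdeal 𝒜).map (fn 𝒜) * ⊤,
      H.iota (map f hf y) - map f hf (G.iota y) = 0 := by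
    intro y hy
    induction hy using Submodule.mul_induction_on' with
    | mem_mul_mem a ha z _ =>
      obtain ⟨a, ha, rfl⟩ := ha
      rw [map_mul, iota_mul, iota_mul, map_fn, iota_fn, iota_fn, zero_mul, zero_mul, zero_add,
        zero_add, eps_fn, eps_fn, map_mul, map_fn, ← mul_sub]
      exact hI _ (map_mem_oddIdeal f hf ha) _ (G.iota_map_sub_mem H f hf z)
    | add x _ y _ hx hy =>
      simp only [map_add, add_sub_add_comm]
      rw [hx, hy, add_zero]
  simpa [iota_iota] using hN _ (G.iota_mem_oddIdeal x)

/-- The local homotopies commute with homomorphisms of superalgebras, for any choice of weight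
gradings. Applied to the identity, this says that the homotopy does not depend on the grading.
Write `h` and `h'` for the two homotopies and `f` for the map of forms. Since `h' f h = 0`,
inserting `1 = d h + h d` on the right of `h' f` and `1 = d h' + h' d` on the left of `f h`
gives `h' d f h` in both cases. -/
theorem map_homotopy [CharZero k] (hf : ∀ i, ∀ a ∈ 𝒜 i, f a ∈ ℬ i)
    (hB : oddIdeal ℬ * oddIdeal ℬ * oddIdeal ℬ = ⊥) {x : Forms 𝒜}
    (hx : G.proj 0 x = 0) (hx' : H.proj 0 (map f hf (G.homotopy x)) = 0) :
    map f hf (G.homotopy x) = H.homotopy (map f hf x) := by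
  have h0 : ∀ y, H.homotopy (map f hf (G.homotopy y)) = 0 := fun y => by
    rw [homotopy_eq_lieInv_iota, G.homotopy_apply, G.iota_map_iota H f hf hB, map_zero]
  have h1 := H.d_homotopy (map f hf (G.homotopy x))
  have h2 := congrArg (fun y => H.homotopy (map f hf y)) (G.d_homotopy x)
  rw [h0, map_zero, zero_add, hx', sub_zero] at h1
  simp only [map_add, h0, add_zero, hx, sub_zero, map_d] at h2
  rw [← h1, h2]

end WeightGrading

/-! ### Weight gradings from odd coordinates -/

section

open Forms

variable {k A : Type u} [Field k] [Ring A] [Algebra k A] {𝒜 : ZMod 2 → Submodule k A}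

theorem IsSuperalgebra.eq_zero_of_mem (hA : IsSuperalgebra 𝒜) {a : A} (h0 : a ∈ 𝒜 0)
    (h1 : a ∈ 𝒜 1) : a = 0 :=
  Submodule.disjoint_def.mp
    (hA.internal.submodule_iSupIndep.pairwiseDisjoint (show (0 : ZMod 2) ≠ 1 by decide)) a h0 h1

theorem IsSuperalgebra.even_comm (hA : IsSuperalgebra 𝒜) {i : ZMod 2} {a b : A} (ha : a ∈ 𝒜 0)
    (hb : b ∈ 𝒜 i) : b * a = a * b := by
  simpa using hA.comm i 0 b a hb ha

theorem IsSuperalgebra.odd_comm (hA : IsSuperalgebra 𝒜) {a b : A} (ha : a ∈ 𝒜 1)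
    (hb : b ∈ 𝒜 1) : b * a = -(a * b) := by
  have h := hA.comm 1 1 b a hb ha
  rw [show (1 : ZMod 2) * 1 = 1 by decide] at h
  simpa using h

/-- A decomposition of a superalgebra into subspaces of weights `0`, `1` and `2` that is compatible
with products and parity defines a weight grading. The ideal
generated by odd elements then lies in positive weight, so its cube, which has weight at
least `3`, vanishes. -/
theorem exists_weightGrading (hA : IsSuperalgebra 𝒜) (S₀ S₁ S₂ : Submodule k A)
    (hex : ∀ a, ∃ x ∈ S₀, ∃ y ∈ S₁, ∃ z ∈ S₂, x + y + z = a)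
    (huniq : ∀ x ∈ S₀, ∀ y ∈ S₁, ∀ z ∈ S₂, x + y + z = 0 → x = 0 ∧ y = 0 ∧ z = 0)
    (hS₀ : S₀ ≤ 𝒜 0) (hS₁ : S₁ ≤ 𝒜 1) (hS₂ : S₂ ≤ 𝒜 0)
    (hS₂N : S₂ ≤ oddIdeal 𝒜 * oddIdeal 𝒜) (one : 1 ∈ S₀)
    (m00 : ∀ x ∈ S₀, ∀ y ∈ S₀, x * y ∈ S₀) (m01 : ∀ x ∈ S₀, ∀ y ∈ S₁, x * y ∈ S₁)
    (m02 : ∀ x ∈ S₀, ∀ y ∈ S₂, x * y ∈ S₂) (m11 : ∀ x ∈ S₁, ∀ y ∈ S₁, x * y ∈ S₂)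
    (m12 : ∀ x ∈ S₁, ∀ y ∈ S₂, x * y = 0) (m22 : ∀ x ∈ S₂, ∀ y ∈ S₂, x * y = 0) :
    Nonempty (WeightGrading 𝒜) ∧ oddIdeal 𝒜 * oddIdeal 𝒜 * oddIdeal 𝒜 = ⊥ := by
  have m10 : ∀ x ∈ S₁, ∀ y ∈ S₀, x * y ∈ S₁ := fun x hx y hy => by
    rw [hA.even_comm (hS₀ hy) (hS₁ hx)]; exact m01 y hy x hx
  have m20 : ∀ x ∈ S₂, ∀ y ∈ S₀, x * y ∈ S₂ := fun x hx y hy => by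
    rw [hA.even_comm (hS₀ hy) (hS₂ hx)]; exact m02 y hy x hx
  have m21 : ∀ x ∈ S₂, ∀ y ∈ S₁, x * y = 0 := fun x hx y hy => by
    rw [← hA.even_comm (hS₂ hx) (hS₁ hy)]; exact m12 y hy x hx
  choose p₀ h₀ p₁ h₁ p₂ h₂ hp using hex
  have key : ∀ a, ∀ x ∈ S₀, ∀ y ∈ S₁, ∀ z ∈ S₂, x + y + z = a →
      p₀ a = x ∧ p₁ a = y ∧ p₂ a = z := by
    intro a x hx y hy z hz h
    have := huniq _ (sub_mem (h₀ a) hx) _ (sub_mem (h₁ a) hy) _ (sub_mem (h₂ a) hz) (by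
      rw [sub_add_sub_comm, sub_add_sub_comm, hp, h, sub_self])
    simpa only [sub_eq_zero] using this
  have k0 : ∀ x ∈ S₀, p₀ x = x ∧ p₁ x = 0 ∧ p₂ x = 0 := fun x hx =>
    key x x hx 0 (zero_mem _) 0 (zero_mem _) (by simp)
  have k1 : ∀ x ∈ S₁, p₀ x = 0 ∧ p₁ x = x ∧ p₂ x = 0 := fun x hx =>
    key x 0 (zero_mem _) x hx 0 (zero_mem _) (by simp)
  have k2 : ∀ x ∈ S₂, p₀ x = 0 ∧ p₁ x = 0 ∧ p₂ x = x := fun x hx =>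
    key x 0 (zero_mem _) 0 (zero_mem _) x hx (by simp)
  have hadd : ∀ a b, p₀ (a + b) = p₀ a + p₀ b ∧ p₁ (a + b) = p₁ a + p₁ b ∧
      p₂ (a + b) = p₂ a + p₂ b := fun a b =>
    key _ _ (add_mem (h₀ a) (h₀ b)) _ (add_mem (h₁ a) (h₁ b)) _ (add_mem (h₂ a) (h₂ b)) (by
      conv_rhs => rw [← hp a, ← hp b]
      abel)
  have hsmul : ∀ (c : k) (a : A), p₀ (c • a) = c • p₀ a ∧ p₁ (c • a) = c • p₁ a ∧
      p₂ (c • a) = c • p₂ a := fun c a =>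
    key _ _ (S₀.smul_mem c (h₀ a)) _ (S₁.smul_mem c (h₁ a)) _ (S₂.smul_mem c (h₂ a)) (by
      rw [← smul_add, ← smul_add, hp])
  have hmul : ∀ a b, p₀ (a * b) = p₀ a * p₀ b ∧ p₁ (a * b) = p₀ a * p₁ b + p₁ a * p₀ b ∧
      p₂ (a * b) = p₀ a * p₂ b + p₁ a * p₁ b + p₂ a * p₀ b := fun a b =>
    key _ _ (m00 _ (h₀ a) _ (h₀ b)) _ (add_mem (m01 _ (h₀ a) _ (h₁ b)) (m10 _ (h₁ a) _ (h₀ b))) _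
      (add_mem (add_mem (m02 _ (h₀ a) _ (h₂ b)) (m11 _ (h₁ a) _ (h₁ b)))
        (m20 _ (h₂ a) _ (h₀ b))) (by
      conv_rhs => rw [← hp a, ← hp b]
      simp only [add_mul, mul_add, m12 _ (h₁ a) _ (h₂ b), m21 _ (h₂ a) _ (h₁ b),
        m22 _ (h₂ a) _ (h₂ b)]
      abel)
  let L : A →ₗ[k] A[X] :=
    { toFun := fun a => monomial 0 (p₀ a) + monomial 1 (p₁ a) + monomial 2 (p₂ a)
      map_add' := fun a b => by
        rw [(hadd a b).1, (hadd a b).2.1, (hadd a b).2.2]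
        simp only [map_add]
        abel
      map_smul' := fun c a => by
        rw [(hsmul c a).1, (hsmul c a).2.1, (hsmul c a).2.2]
        simp only [smul_add, smul_monomial, RingHom.id_apply] }
  have hL : ∀ a, L a = monomial 0 (p₀ a) + monomial 1 (p₁ a) + monomial 2 (p₂ a) := fun _ => rfl
  have hL0 : ∀ x ∈ S₀, L x = monomial 0 x := fun x hx => by simp [hL, k0 x hx]
  have hL1 : ∀ x ∈ S₁, L x = monomial 1 x := fun x hx => by simp [hL, k1 x hx]
  have hL2 : ∀ x ∈ S₂, L x = monomial 2 x := fun x hx => by simp [hL, k2 x hx]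
  have hcoeff : ∀ a w, (L a).coeff w =
      if w = 0 then p₀ a else if w = 1 then p₁ a else if w = 2 then p₂ a else 0 := by
    intro a w
    simp only [hL, coeff_add, coeff_monomial]
    rcases w with _ | _ | _ | w <;> simp
  -- Even elements have no component of weight one, and odd elements have no others.
  have heven : ∀ a ∈ 𝒜 0, p₁ a = 0 := fun a ha => by
    refine hA.eq_zero_of_mem ?_ (hS₁ (h₁ a))
    rw [show p₁ a = a - p₀ a - p₂ a by
      rw [sub_sub, eq_sub_iff_add_eq, add_left_comm, ← add_assoc, hp]]
    exact sub_mem (sub_mem ha (hS₀ (h₀ a))) (hS₂ (h₂ a))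
  have hodd : ∀ a ∈ 𝒜 1, a ∈ S₁ := fun a ha => by
    have h : a - p₁ a = 0 := by
      refine hA.eq_zero_of_mem ?_ (sub_mem ha (hS₁ (h₁ a)))
      rw [show a - p₁ a = p₀ a + p₂ a by rw [sub_eq_iff_eq_add, add_right_comm, hp]]
      exact add_mem (hS₀ (h₀ a)) (hS₂ (h₂ a))
    rw [sub_eq_zero.mp h]
    exact h₁ a
  have hLone : L 1 = 1 := hL0 1 one
  have hLmul : ∀ a b, L (a * b) = L a * L b := fun a b => by
    rw [hL, (hmul a b).1, (hmul a b).2.1, (hmul a b).2.2, hL, hL]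
    simp only [add_mul, mul_add, monomial_mul_monomial, m12 _ (h₁ a) _ (h₂ b),
      m21 _ (h₂ a) _ (h₁ b), m22 _ (h₂ a) _ (h₂ b), map_add, map_zero]
    abel
  have hmem : ∀ {i : ZMod 2} {a : A}, a ∈ 𝒜 i → ∀ w, (L a).coeff w ∈ 𝒜 i := by
    intro i a ha w
    rw [hcoeff]
    fin_cases i
    · change _ ∈ 𝒜 0
      split_ifs
      · exact hS₀ (h₀ a)
      · rw [heven a ha]; exact zero_mem _
      · exact hS₂ (h₂ a)
      · exact zero_mem _
    · change _ ∈ 𝒜 1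
      obtain ⟨e0, e1, e2⟩ := k1 a (hodd a ha)
      rw [e0, e1, e2]
      split_ifs <;> first | exact zero_mem _ | exact ha
  have hLL : ∀ a w, L ((L a).coeff w) = monomial w ((L a).coeff w) := by
    intro a w
    rw [hcoeff]
    split_ifs with e0 e1 e2
    · rw [e0, hL0 _ (h₀ a)]
    · rw [e1, hL1 _ (h₁ a)]
    · rw [e2, hL2 _ (h₂ a)]
    · simp
  have hsq : ∀ a ∈ 𝒜 0, ∀ w, (L a).coeff (w + 1) ∈ oddIdeal 𝒜 * oddIdeal 𝒜 := by
    intro a ha w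
    rw [hcoeff]
    simp only [Nat.add_eq_zero_iff, one_ne_zero, and_false, if_false]
    split_ifs
    · rw [heven a ha]; exact zero_mem _
    · exact hS₂N (h₂ a)
    · exact zero_mem _
  let G : WeightGrading 𝒜 :=
    { isSuperalgebra := hA
      φ := AlgHom.ofLinearMap L hLone hLmul
      coeff_mem := hmem
      eval_one := fun a => by
        change (L a).eval 1 = a
        rw [hL]
        simpa using hp a
      φ_coeff := hLL
      φ_odd := fun a ha => hL1 a (hodd a ha)
      coeff_even := hsq }
  refine ⟨⟨G⟩, ?_⟩
  have hN : ∀ a ∈ oddIdeal 𝒜, p₁ a + p₂ a = a := fun a ha => by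
    have h : (L a).coeff 0 = 0 := G.coeff_zero_oddIdeal ha
    rw [hcoeff, if_pos rfl] at h
    conv_rhs => rw [← hp a, h, zero_add]
  have hN2 : oddIdeal 𝒜 * oddIdeal 𝒜 ≤ S₂ := Submodule.mul_le.mpr fun a ha b hb => by
    rw [← hN a ha, ← hN b hb]
    simp only [add_mul, mul_add, m12 _ (h₁ a) _ (h₂ b), m21 _ (h₂ a) _ (h₁ b),
      m22 _ (h₂ a) _ (h₂ b), add_zero]
    exact m11 _ (h₁ a) _ (h₁ b)
  refine le_bot_iff.mp (Submodule.mul_le.mpr fun a ha b hb => ?_)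
  rw [← hN b hb, mul_add, m21 _ (hN2 ha) _ (h₁ b), m22 _ (hN2 ha) _ (h₂ b), add_zero]
  exact zero_mem _

/-- If `A` is freely generated by two odd elements `θ` and `η` over a subalgebra `R` of even
elements, then `A = R ⊕ (R θ + R η) ⊕ R θ η` defines a weight grading, and `N ^ 3 = 0`. -/
theorem exists_weightGrading_of_coordinates (hA : IsSuperalgebra 𝒜) {R : Type u} [CommRing R]
    (σ : R →+* A) (hσ : ∀ r, σ r ∈ 𝒜 0) (hk : ∀ c : k, ∃ r, σ r = algebraMap k A c) (θ η : A)
    (hθ : θ ∈ 𝒜 1) (hη : η ∈ 𝒜 1)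
    (hsurj : ∀ a, ∃ r₀ r₁ r₂ r₃, σ r₀ + (σ r₁ * θ + σ r₂ * η) + σ r₃ * (θ * η) = a)
    (hinj : ∀ r₀ r₁ r₂ r₃, σ r₀ + (σ r₁ * θ + σ r₂ * η) + σ r₃ * (θ * η) = 0 →
      r₀ = 0 ∧ r₁ = 0 ∧ r₂ = 0 ∧ r₃ = 0) :
    Nonempty (WeightGrading 𝒜) ∧ oddIdeal 𝒜 * oddIdeal 𝒜 * oddIdeal 𝒜 = ⊥ := by
  have hsmul : ∀ (c : k), ∃ r, ∀ x : A, c • x = σ r * x := fun c => by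
    obtain ⟨r, hr⟩ := hk c
    exact ⟨r, fun x => by rw [Algebra.smul_def, hr]⟩
  have cθ : ∀ r, θ * σ r = σ r * θ := fun r => hA.even_comm (hσ r) hθ
  have cη : ∀ r, η * σ r = σ r * η := fun r => hA.even_comm (hσ r) hη
  have hθθ : θ * θ = 0 := hA.odd_sq θ hθ
  have hηη : η * η = 0 := hA.odd_sq η hη
  have hηθ : η * θ = -(θ * η) := hA.odd_comm hθ hη
  have cθ' : ∀ r x, θ * (σ r * x) = σ r * (θ * x) := fun r x => by rw [← mul_assoc, cθ, mul_assoc]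
  have cη' : ∀ r x, η * (σ r * x) = σ r * (η * x) := fun r x => by rw [← mul_assoc, cη, mul_assoc]
  have hθθ' : ∀ x, θ * (θ * x) = 0 := fun x => by rw [← mul_assoc, hθθ, zero_mul]
  have hηηθ : η * (θ * η) = 0 := by
    rw [← mul_assoc, hηθ, neg_mul, mul_assoc, hηη, mul_zero, neg_zero]
  let S₀ : Submodule k A :=
    { carrier := {x | ∃ r, σ r = x}
      add_mem' := by
        rintro _ _ ⟨r, rfl⟩ ⟨s, rfl⟩
        exact ⟨r + s, map_add _ _ _⟩
      zero_mem' := ⟨0, map_zero _⟩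
      smul_mem' := by
        rintro c _ ⟨r, rfl⟩
        obtain ⟨s, hs⟩ := hsmul c
        exact ⟨s * r, by rw [hs, map_mul]⟩ }
  let S₁ : Submodule k A :=
    { carrier := {x | ∃ r s, σ r * θ + σ s * η = x}
      add_mem' := by
        rintro _ _ ⟨r, s, rfl⟩ ⟨r', s', rfl⟩
        exact ⟨r + r', s + s', by simp only [map_add, add_mul]; abel⟩
      zero_mem' := ⟨0, 0, by simp⟩
      smul_mem' := by
        rintro c _ ⟨r, s, rfl⟩
        obtain ⟨t, ht⟩ := hsmul c
        exact ⟨t * r, t * s, by simp only [ht, map_mul, mul_add, mul_assoc]⟩ }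
  let S₂ : Submodule k A :=
    { carrier := {x | ∃ r, σ r * (θ * η) = x}
      add_mem' := by
        rintro _ _ ⟨r, rfl⟩ ⟨s, rfl⟩
        exact ⟨r + s, by rw [map_add, add_mul]⟩
      zero_mem' := ⟨0, by simp⟩
      smul_mem' := by
        rintro c _ ⟨r, rfl⟩
        obtain ⟨s, hs⟩ := hsmul c
        exact ⟨s * r, by rw [hs, map_mul, mul_assoc]⟩ }
  have modd : ∀ r, ∀ x ∈ 𝒜 1, σ r * x ∈ 𝒜 1 := fun r x hx => by
    simpa using hA.mul_mem _ _ _ _ (hσ r) hx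
  refine exists_weightGrading hA S₀ S₁ S₂ ?_ ?_ ?_ ?_ ?_ ?_ ⟨1, map_one σ⟩ ?_ ?_ ?_ ?_ ?_ ?_
  · intro a
    obtain ⟨r₀, r₁, r₂, r₃, h⟩ := hsurj a
    exact ⟨_, ⟨r₀, rfl⟩, _, ⟨r₁, r₂, rfl⟩, _, ⟨r₃, rfl⟩, h⟩
  · rintro _ ⟨r₀, rfl⟩ _ ⟨r₁, r₂, rfl⟩ _ ⟨r₃, rfl⟩ h
    obtain ⟨rfl, rfl, rfl, rfl⟩ := hinj _ _ _ _ h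
    simp
  · rintro _ ⟨r, rfl⟩
    exact hσ r
  · rintro _ ⟨r, s, rfl⟩
    exact add_mem (modd r θ hθ) (modd s η hη)
  · rintro _ ⟨r, rfl⟩
    rw [← mul_assoc]
    exact hA.mul_mem 1 1 _ _ (modd r θ hθ) hη
  · rintro _ ⟨r, rfl⟩
    rw [← mul_assoc]
    exact Submodule.mul_mem_mul (mem_oddIdeal (modd r θ hθ)) (mem_oddIdeal hη)
  · rintro _ ⟨r, rfl⟩ _ ⟨s, rfl⟩
    exact ⟨r * s, map_mul _ _ _⟩
  · rintro _ ⟨r, rfl⟩ _ ⟨s, t, rfl⟩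
    exact ⟨r * s, r * t, by simp only [map_mul, mul_add, mul_assoc]⟩
  · rintro _ ⟨r, rfl⟩ _ ⟨s, rfl⟩
    exact ⟨r * s, by rw [map_mul, mul_assoc]⟩
  · rintro _ ⟨r, s, rfl⟩ _ ⟨t, u, rfl⟩
    refine ⟨r * u - s * t, ?_⟩
    simp only [map_sub, map_mul, add_mul, mul_add, mul_assoc, cθ', cη', hθθ, hηη, hηθ, mul_zero,
      sub_mul, mul_neg]
    abel
  · rintro _ ⟨r, s, rfl⟩ _ ⟨t, rfl⟩
    simp only [add_mul, mul_assoc, cθ', cη', hθθ', hηηθ, mul_zero, add_zero]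
  · rintro _ ⟨r, rfl⟩ _ ⟨t, rfl⟩
    simp only [mul_assoc, cη', hηηθ, mul_zero]

end

/-! ### Homotopies defined on a base of a site -/

section Site

universe v₁ v₂ v₃ u₁ u₂ u₃

variable {C : Type u₁} [Category.{v₁} C] {D : Type u₂} [Category.{v₂} D]
  {J : GrothendieckTopology C} {F : D ⥤ C} [F.IsCoverDense J] [F.IsLocallyFull J]
  {A : Type u₃} [Category.{v₃} A] [HasWeakSheafify J A]

/-- A morphism from the sheaf associated with a presheaf is determined by its values on sections of
the presheaf over objects of a base. -/
theorem sheafify_hom_ext_of_base {P : Cᵒᵖ ⥤ A} {Q : Sheaf J A}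
    {f g : (presheafToSheaf J A).obj P ⟶ Q}
    (h : Functor.whiskerLeft F.op (toSheafify J P ≫ f.hom) =
      Functor.whiskerLeft F.op (toSheafify J P ≫ g.hom)) : f = g := by
  apply Sheaf.hom_ext
  refine sheafify_hom_ext J _ _ Q.property ?_
  exact (Functor.IsCoverDense.restrictHomEquivHom (G := F) (ℱ := P) (ℱ' := Q)).symm.injective h

/-- The morphism of associated sheaves defined by a morphism of presheaves on a base. -/
def sheafifyHomOfBase {P Q : Cᵒᵖ ⥤ A} (β : F.op ⋙ P ⟶ F.op ⋙ Q) :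
    (presheafToSheaf J A).obj P ⟶ (presheafToSheaf J A).obj Q :=
  ⟨sheafifyLift J (Functor.IsCoverDense.sheafHom (G := F) (ℱ' := (presheafToSheaf J A).obj Q)
    (β ≫ Functor.whiskerLeft F.op (toSheafify J Q))) ((presheafToSheaf J A).obj Q).property⟩

theorem whiskerLeft_sheafifyHomOfBase {P Q : Cᵒᵖ ⥤ A} (β : F.op ⋙ P ⟶ F.op ⋙ Q) :
    Functor.whiskerLeft F.op (toSheafify J P ≫ (sheafifyHomOfBase (J := J) β).hom) =
      β ≫ Functor.whiskerLeft F.op (toSheafify J Q) := by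
  rw [sheafifyHomOfBase, toSheafify_sheafifyLift]
  exact Functor.IsCoverDense.sheafHom_restrict_eq _

theorem sheafifyHomOfBase_comp {P Q R : Cᵒᵖ ⥤ A} (β : F.op ⋙ P ⟶ F.op ⋙ Q)
    (γ : F.op ⋙ Q ⟶ F.op ⋙ R) : sheafifyHomOfBase (J := J) (β ≫ γ) =
      sheafifyHomOfBase β ≫ sheafifyHomOfBase γ := by
  refine sheafify_hom_ext_of_base (F := F) ?_
  change _ = Functor.whiskerLeft F.op (toSheafify J P ≫ (sheafifyHomOfBase β).hom ≫
    (sheafifyHomOfBase γ).hom)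
  rw [whiskerLeft_sheafifyHomOfBase, ← Category.assoc, Functor.whiskerLeft_comp,
    whiskerLeft_sheafifyHomOfBase, Category.assoc, Category.assoc,
    ← whiskerLeft_sheafifyHomOfBase γ, Functor.whiskerLeft_comp]

theorem sheafifyHomOfBase_whiskerLeft {P Q : Cᵒᵖ ⥤ A} (φ : P ⟶ Q) :
    sheafifyHomOfBase (J := J) (Functor.whiskerLeft F.op φ) = (presheafToSheaf J A).map φ := by
  refine sheafify_hom_ext_of_base (F := F) ?_
  rw [whiskerLeft_sheafifyHomOfBase, ← Functor.whiskerLeft_comp, toSheafify_naturality]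

theorem sheafifyHomOfBase_add [Preadditive A] {P Q : Cᵒᵖ ⥤ A} (β γ : F.op ⋙ P ⟶ F.op ⋙ Q) :
    sheafifyHomOfBase (J := J) (β + γ) = sheafifyHomOfBase β + sheafifyHomOfBase γ := by
  refine sheafify_hom_ext_of_base (F := F) ?_
  have h : ∀ f g : (presheafToSheaf J A).obj P ⟶ (presheafToSheaf J A).obj Q,
      Functor.whiskerLeft F.op (toSheafify J P ≫ (f + g).hom) =
      Functor.whiskerLeft F.op (toSheafify J P ≫ f.hom) +
        Functor.whiskerLeft F.op (toSheafify J P ≫ g.hom) := by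
    intro f g
    ext X
    simp
  rw [h, whiskerLeft_sheafifyHomOfBase, whiskerLeft_sheafifyHomOfBase,
    whiskerLeft_sheafifyHomOfBase, Preadditive.add_comp]

theorem sheafifyHomOfBase_id {P : Cᵒᵖ ⥤ A} :
    sheafifyHomOfBase (J := J) (𝟙 (F.op ⋙ P)) = 𝟙 ((presheafToSheaf J A).obj P) := by
  rw [← (presheafToSheaf J A).map_id, ← sheafifyHomOfBase_whiskerLeft (F := F)]
  rfl

/-- A contraction of a complex of presheaves over a base induces a contraction of the complex of
associated sheaves. -/
theorem nonempty_homotopy_of_base [Preadditive A] [(presheafToSheaf J A).Additive]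
    (P : CochainComplex (Cᵒᵖ ⥤ A) ℕ)
    (α : ∀ n, F.op ⋙ P.X (n + 1) ⟶ F.op ⋙ P.X n)
    (h₀ : Functor.whiskerLeft F.op (P.d 0 1) ≫ α 0 = 𝟙 _)
    (h : ∀ n, Functor.whiskerLeft F.op (P.d (n + 1) (n + 2)) ≫ α (n + 1) +
      α n ≫ Functor.whiskerLeft F.op (P.d n (n + 1)) = 𝟙 _) :
    Nonempty (Homotopy
      (𝟙 (((presheafToSheaf J A).mapHomologicalComplex _).obj P)) 0) := by
  -- The components of the homotopy are indexed by pairs `i, j` with `i = j + 1`, hence `eqToHom`.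
  let K := ((presheafToSheaf J A).mapHomologicalComplex (ComplexShape.up ℕ)).obj P
  let η : ∀ n, K.X (n + 1) ⟶ K.X n := fun n => sheafifyHomOfBase (α n)
  have key : 𝟙 K = Homotopy.nullHomotopicMap' (C := K) (D := K)
      (fun i j hij => eqToHom (congrArg K.X (show i = j + 1 from hij.symm)) ≫ η j) := by
    ext1 n
    rcases n with _ | n
    · rw [Homotopy.nullHomotopicMap'_f_of_not_rel_right (k₁ := 0) (k₀ := 1) rfl (by simp),
        eqToHom_refl, Category.id_comp]
      change _ = (presheafToSheaf J A).map (P.d 0 1) ≫ sheafifyHomOfBase (α 0)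
      rw [← sheafifyHomOfBase_whiskerLeft (F := F), ← sheafifyHomOfBase_comp, h₀,
        sheafifyHomOfBase_id]
      rfl
    · rw [Homotopy.nullHomotopicMap'_f (k₂ := n) (k₁ := n + 1) (k₀ := n + 2) rfl rfl,
        eqToHom_refl, Category.id_comp, eqToHom_refl, Category.id_comp]
      change _ = (presheafToSheaf J A).map (P.d (n + 1) (n + 2)) ≫ sheafifyHomOfBase (α (n + 1)) +
        sheafifyHomOfBase (α n) ≫ (presheafToSheaf J A).map (P.d n (n + 1))
      rw [← sheafifyHomOfBase_whiskerLeft (F := F), ← sheafifyHomOfBase_whiskerLeft (F := F),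
        ← sheafifyHomOfBase_comp, ← sheafifyHomOfBase_comp, ← sheafifyHomOfBase_add, h,
        sheafifyHomOfBase_id]
      rfl
  exact ⟨(Homotopy.ofEq key).trans (Homotopy.nullHomotopy' _)⟩

end Site

/-! ### The homotopy on a superspace -/

namespace Superspace

open Forms

variable {k : Type u} [Field k] (X : Superspace k)

/-- The sections of a superspace over an open subset admit a weight grading, and the cube of the
ideal generated by odd sections vanishes. -/
def IsGraded (U : Opens X.carrier) : Prop :=
  Nonempty (WeightGrading (X.part U)) ∧
    oddIdeal (X.part U) * oddIdeal (X.part U) * oddIdeal (X.part U) = ⊥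

theorem Chart.isGraded {X : Superspace k} {n : ℕ} (c : X.Chart n 2) (W : c.Z.Opens) :
    X.IsGraded ((IsOpenMap.functor (f := c.f) c.isOpenEmbedding.isOpenMap).obj W) := by
  set r := (IsOpenMap.functor (f := c.f) c.isOpenEmbedding.isOpenMap).map
    (homOfLE (le_top : W ≤ ⊤)) with hr
  have hsum : ∀ s : Finset (Fin 2) → Γ(c.Z, W), ∑ I, c.σ W (s I) *
      (X.presheaf.map r.op).hom ((I.sort (· ≤ ·)).map c.θ).prod =
      c.σ W (s ∅) + (c.σ W (s {0}) * (X.presheaf.map r.op).hom (c.θ 0) +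
        c.σ W (s {1}) * (X.presheaf.map r.op).hom (c.θ 1)) +
        c.σ W (s {0, 1}) * ((X.presheaf.map r.op).hom (c.θ 0) *
          (X.presheaf.map r.op).hom (c.θ 1)) := by
    intro s
    rw [show (Finset.univ : Finset (Finset (Fin 2))) = {∅, {0}, {1}, {0, 1}} by decide]
    have h01 : ({0, 1} : Finset (Fin 2)).sort (· ≤ ·) = [0, 1] := by
      rw [Finset.sort_insert _ (by simp) (by simp), Finset.sort_singleton]
    rw [Finset.sum_insert (by decide), Finset.sum_insert (by decide), Finset.sum_insert (by decide),
      Finset.sum_singleton, h01]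
    simp only [Finset.sort_empty, Finset.sort_singleton, List.map_nil, List.map_cons, List.prod_nil,
      List.prod_cons, map_one, map_mul, mul_one]
    abel
  have hb := c.bijective W
  refine exists_weightGrading_of_coordinates (X.isSuperalgebra _) (c.σ W) (c.σ_even W) ?_
    ((X.presheaf.map r.op).hom (c.θ 0)) ((X.presheaf.map r.op).hom (c.θ 1))
    (X.res_mem r.op 1 _ (c.θ_odd 0)) (X.res_mem r.op 1 _ (c.θ_odd 1)) ?_ ?_
  · intro a
    refine ⟨_, (c.σ_res ⊤ W (homOfLE le_top)
      (c.str.appTop ((Scheme.ΓSpecIso (CommRingCat.of k)).inv a))).symm.trans ?_⟩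
    rw [c.σ_algebraMap]
    exact (X.presheaf.map r.op).hom.commutes a
  · intro a
    obtain ⟨s, hs⟩ := hb.2 a
    exact ⟨_, _, _, _, (hsum s).symm.trans hs⟩
  · intro r₀ r₁ r₂ r₃ h
    let s : Finset (Fin 2) → Γ(c.Z, W) := fun I =>
      if 0 ∈ I then (if 1 ∈ I then r₃ else r₁) else (if 1 ∈ I then r₂ else r₀)
    have hs : s = 0 := by
      apply hb.1
      refine ((hsum s).trans ?_).trans (hsum 0).symm
      simpa [s] using h
    exact ⟨by simpa [s] using congrFun hs ∅, by simpa [s] using congrFun hs {0},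
      by simpa [s] using congrFun hs {1}, by simpa [s] using congrFun hs {0, 1}⟩

/-- The base of open subsets over which the local homotopy is defined. -/
abbrev gradedOpen : {U : Opens X.carrier // X.IsGraded U} → Opens X.carrier := Subtype.val

theorem isBasis_gradedOpen {n : ℕ} (hX : X.IsSmoothOfDimension n 2) :
    Opens.IsBasis (Set.range X.gradedOpen) := by
  rw [Opens.isBasis_iff_nbhd]
  intro U x hx
  obtain ⟨c, z, rfl⟩ := hX x
  refine ⟨_, ⟨⟨_, c.isGraded ((Opens.map c.f).obj U)⟩, rfl⟩, ⟨z, hx, rfl⟩, ?_⟩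
  rintro _ ⟨y, hy, rfl⟩
  exact hy

/-- The de Rham differential as a morphism of presheaves. -/
def formsPresheafD (i n : ℕ) (p : ZMod 2) :
    X.formsPresheaf i n p ⟶ X.formsPresheaf i (n + 1) p where
  app U := ModuleCat.ofHom (dPiece (X.isSuperalgebra U.unop) i n p)
  naturality U V f := by
    ext x
    exact Subtype.ext (Forms.map_d _ _ _).symm

theorem deRhamPresheaf_d (i n : ℕ) (p : ZMod 2) :
    (X.deRhamPresheaf i p).d n (n + 1) = X.formsPresheafD i n p :=
  CochainComplex.of_d (fun n => X.formsPresheaf i n p) (fun n => X.formsPresheafD i n p) n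

variable [CharZero k]

/-- Odd forms and forms in the first step of the filtration have no component of weight zero. -/
theorem _root_.SuperGeom.WeightGrading.proj_zero_filtPiece {A : Type u} [Ring A] [Algebra k A]
    {𝒜 : ZMod 2 → Submodule k A} (G : WeightGrading 𝒜) {i n : ℕ} {p : ZMod 2}
    (h : 1 ≤ i ∨ p = 1) {x : Forms 𝒜} (hx : x ∈ filtPiece 𝒜 i n p) : G.proj 0 x = 0 := by
  rcases h with h | rfl
  · obtain ⟨i, rfl⟩ := Nat.exists_eq_add_of_le' h
    exact G.proj_zero_filt hx.1
  · exact G.proj_zero_piece_one hx.2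

/-- The local homotopies for chosen weight gradings. They are natural in the open subset although
the choices are not, because they do not depend on the weight grading. -/
def localHomotopy {i : ℕ} {p : ZMod 2} (h : 1 ≤ i ∨ p = 1) (n : ℕ) :
    (inducedFunctor X.gradedOpen).op ⋙ X.formsPresheaf i (n + 1) p ⟶
      (inducedFunctor X.gradedOpen).op ⋙ X.formsPresheaf i n p where
  app U := ModuleCat.ofHom
    (U.unop.2.1.some.homotopy.restrict fun _ hx => U.unop.2.1.some.homotopy_mem hx)
  naturality U V f := by
    ext x
    let G := U.unop.2.1.some
    refine Subtype.ext (WeightGrading.map_homotopy G _ _ _ V.unop.2.2 ?_ ?_).symm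
    · exact WeightGrading.proj_zero_filtPiece _ h x.2
    · refine WeightGrading.proj_zero_filtPiece (i := i) (n := n) _ h ?_
      exact ⟨map_filt _ _ _ _ (G.homotopy_mem x.2).1, map_piece _ _ _ _ _ (G.homotopy_mem x.2).2⟩

theorem nonempty_homotopy {n : ℕ} (hX : X.IsSmoothOfDimension n 2) {i : ℕ} {p : ZMod 2}
    (h : 1 ≤ i ∨ p = 1) : Nonempty (Homotopy (𝟙 (X.filteredDeRham i p)) 0) := by
  have := TopCat.Opens.coverDense_inducedFunctor (X.isBasis_gradedOpen hX)
  refine nonempty_homotopy_of_base (F := inducedFunctor X.gradedOpen) (X.deRhamPresheaf i p)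
    (X.localHomotopy h) ?_ fun n => ?_
  · rw [deRhamPresheaf_d]
    change Functor.whiskerLeft _ (X.formsPresheafD i 0 p) ≫ X.localHomotopy h 0 =
      𝟙 (_ ⋙ X.formsPresheaf i 0 p)
    ext U x
    set G := U.unop.2.1.some with hG
    refine Subtype.ext ?_
    change G.homotopy (d _ x.1) = x.1
    have e := G.d_homotopy x.1
    rw [G.homotopy_piece_zero x.2.2, map_zero, zero_add, G.proj_zero_filtPiece h x.2, sub_zero] at e
    exact e
  · rw [deRhamPresheaf_d, deRhamPresheaf_d]
    change Functor.whiskerLeft _ (X.formsPresheafD i (n + 1) p) ≫ X.localHomotopy h (n + 1) +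
      X.localHomotopy h n ≫ Functor.whiskerLeft _ (X.formsPresheafD i n p) =
      𝟙 (_ ⋙ X.formsPresheaf i (n + 1) p)
    ext U x
    set G := U.unop.2.1.some with hG
    refine Subtype.ext ?_
    change G.homotopy (d _ x.1) + d _ (G.homotopy x.1) = x.1
    rw [add_comm, G.d_homotopy, G.proj_zero_filtPiece h x.2, sub_zero]

end Superspace

end SuperGeom

end

/-- For a smooth superscheme `X` of dimension `n|2` over a field of characteristic zero, the odd part
of the de Rham complex and the even part of its subcomplex `F^2` are homotopic to zero, as complexes
of sheaves of `k`-vector spaces on `X`. -/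
theorem proposition2p5 {k : Type u} [Field k] [CharZero k] (n : ℕ) (X : SuperGeom.Superspace k)
    (hX : X.IsSmoothOfDimension n 2) :
    Nonempty (Homotopy (𝟙 (X.deRham 1)) 0) ∧
      Nonempty (Homotopy (𝟙 (X.filteredDeRham 2 0)) 0) :=
  ⟨X.nonempty_homotopy hX (Or.inr rfl), X.nonempty_homotopy hX (Or.inl (by norm_num))⟩
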